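/- Let $A\ge 2$ and $a\in\{1,\dots,A-1\}$. Let $F_1,\dots,F_A:\{1,2,\dots\}\to(0,\infty)$ be feedback functions and $X_1(0),\dots,X_A(0)\in\{1,2,\dots\}$ initial values. Let $\tau_i(k)$ ($1\le i\le A$, $k\ge1$) be independent random variables, $\tau_i(k)$ exponentially distributed with parameter $F_i(k)$, and for $t\ge 0$ let $$\Xi_i(t)=\min\Big\{k:\ \sum_{l=X_i(0)}^{k}\tau_i(l)>t\Big\}\in\{1,2,\dots\}\cup\{\infty\}\qquad(\min\emptyset=\infty)$$ be the corresponding independent birth processes, with explosion times $T_i=\sum_{k\ge X_i(0)}\tau_i(k)\in(0,\infty]$. Let $t_0=0$ and $t_{n+1}=\inf\{t>t_n:\Xi(t)\ne\Xi(t_n)\}$ be the jump times of $\Xi=(\Xi_1,\dots,\Xi_A)$, let $X(n)=\Xi(t_n)$ be the generalized Pólya urn obtained from this exponential embedding, and let $X_i(\infty)=\lim_{n\to\infty}X_i(n)$. Let $$sMon_i=\{\exists N\ge 0\ \forall n\ge N\ \forall j\ne i:\ X_j(n)=X_j(N)\}$$ be the event that colour $i$ is the strong monopolist, let $E=sMon_1^c\cap\dots\cap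 sMon_a^c$ be the event that colours $1,\dots,a$ all lose, and let $\mathbb P_{A,a}(B)=\mathbb P(B\cap E)/\mathbb P(E)$. Assume that $\sum_{k\ge1}1/F_i(k)<\infty$ holds for $i=1,\dots,a$ and for at least one $i\in\{a+1,\dots,A\}$. Put $S=\min\{T_{a+1},\dots,T_A\}$, $G_i(t)=\mathbb P(T_i>t)$, and $g_i(t)=\frac{d}{dt}\mathbb P(T_i\le t)$ for $i\le a$ and $t>0$. Then $\mathbb P(E)>0$, the derivatives $g_i(t)$ exist for all $i\le a$ and $t>0$, and the random variables $\prod_{i=1}^a g_i(S)$ and $\big(\prod_{j\in\{1,\dots,a\}\setminus\{i\}}G_j(S)\big)g_i(S)$, $i\le a$, are integrable. Moreover, as $x\to\infty$ along the positive integers, and with $u(x)\sim v(x)$ meaning $u(x)/v(x)\to1$: 1. $$\mathbb P_{A,a}\big(\min(X_1(\infty),\dots,X_a(\infty))>x\big)\sim\frac{\mathbb E\big[\prod_{i=1}^a g_i(S)\big]}{\mathbb P(E)}\prod_{i=1}^a\Big(\sum_{k=x+1}^\infty\frac1{F_i(k)}\Big).$$ 2. $$\mathbb P_{A,a}\big(\max(X_1(\infty),\dots,X_a(\infty))>x\big)\sim\sum_{i=1}^a\frac{\mathbb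 E\big[\big(\prod_{j\in\{1,\dots,a\}\setminus\{i\}}G_j(S)\big)g_i(S)\big]}{\mathbb P(E)}\sum_{k=x+1}^\infty\frac1{F_i(k)}.$$ 3. If $F_1,\dots,F_a$ are regularly varying (for each $i\le a$ there is $\rho_i\in\mathbb R$ with $F_i(\lfloor cn\rfloor)/F_i(n)\to c^{\rho_i}$ as $n\to\infty$ for every $c>0$), then $$\mathbb P_{A,a}\big(X_1(\infty)+\dots+X_a(\infty)>x\big)\sim\sum_{i=1}^a\frac{\mathbb E\big[\big(\prod_{j\in\{1,\dots,a\}\setminus\{i\}}G_j(S)\big)g_i(S)\big]}{\mathbb P(E)}\sum_{k=x+1}^\infty\frac1{F_i(k)}.$$ -/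

import Mathlib

open MeasureTheory ProbabilityTheory Filter Topology
open scoped ENNReal

noncomputable section

namespace PolyaUrn

/-- `u ∼ v`: the quotient `u n / v n` tends to `1`. -/
def AsympEquiv (u v : ℕ → ℝ) : Prop :=
  Tendsto (fun n => u n / v n) atTop (𝓝 1)

/-- The explosion criterion `∑_{k ≥ 1} 1 / f k < ∞`.  Feedback functions live on `{1, 2, …}`;
the value at `0` is never used. -/
def ExplosionCriterion (f : ℕ → ℝ) : Prop :=
  Summable fun k : ℕ => 1 / f (k + 1)

/-- The tail sum `∑_{k ≥ x + 1} 1 / f k`. -/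
def tailSum (f : ℕ → ℝ) (x : ℕ) : ℝ :=
  ∑' k : ℕ, 1 / f (x + 1 + k)

/-- A sequence is regularly varying (with some index `ρ`) if
`f ⌊c n⌋ / f n → c ^ ρ` for every `c > 0`. -/
def RegularlyVarying (f : ℕ → ℝ) : Prop :=
  ∃ ρ : ℝ, ∀ c : ℝ, 0 < c →
    Tendsto (fun n : ℕ => f ⌊c * (n : ℝ)⌋₊ / f n) atTop (𝓝 (c ^ ρ))

/-! ### One birth process, as a functional of its sojourn times -/

/-- The birth process with initial value `x₀` and sojourn times `σ k`, at time `t ≥ 0`: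
`min {k | ∑_{l = x₀}^k σ l > t}`, where `min ∅ = ∞`. -/
def birthProcess (σ : ℕ → ℝ) (x₀ : ℕ) (t : ℝ) : ℕ∞ :=
  sInf ((fun k : ℕ => (k : ℕ∞)) '' {k : ℕ | t < ∑ l ∈ Finset.Icc x₀ k, σ l})

/-- The explosion time `∑_{k ≥ x₀} σ k ∈ [0, ∞]` (the `σ k` are almost surely positive). -/
def explosionTime (σ : ℕ → ℝ) (x₀ : ℕ) : ℝ≥0∞ :=
  ∑' k : ℕ, ENNReal.ofReal (σ (x₀ + k))

/-! ### The urn, as a functional of the sojourn times `σ i k` of all agents -/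

variable {A : ℕ}

/-- The jump times of the combined process: `t₀ = 0` and
`tₙ₊₁ = inf {t > tₙ | Ξ(t) ≠ Ξ(tₙ)}`. -/
def jumpTime (σ : Fin A → ℕ → ℝ) (x₀ : Fin A → ℕ) : ℕ → ℝ
  | 0 => 0
  | n + 1 => sInf {t : ℝ | jumpTime σ x₀ n < t ∧
      ∃ i, birthProcess (σ i) (x₀ i) t ≠ birthProcess (σ i) (x₀ i) (jumpTime σ x₀ n)}

/-- The generalized Pólya urn given by the exponential embedding: `X(n) = Ξ(tₙ)`. -/
def urn (σ : Fin A → ℕ → ℝ) (x₀ : Fin A → ℕ) (n : ℕ) (i : Fin A) : ℕ∞ :=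
  birthProcess (σ i) (x₀ i) (jumpTime σ x₀ n)

/-- `X_i(∞) = lim_{n → ∞} X_i(n)`. -/
def urnLimit (σ : Fin A → ℕ → ℝ) (x₀ : Fin A → ℕ) (i : Fin A) : ℕ∞ :=
  limUnder atTop fun n => urn σ x₀ n i

/-- Strong monopoly of agent `i`: from some step on, no other agent wins any step. -/
def StrongMonopoly (σ : Fin A → ℕ → ℝ) (x₀ : Fin A → ℕ) (i : Fin A) : Prop :=
  ∃ N : ℕ, ∀ n, N ≤ n → ∀ j, j ≠ i → urn σ x₀ n j = urn σ x₀ N j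

/-- The first `a` of the `A` agents. -/
def firstAgents (A a : ℕ) : Finset (Fin A) :=
  Finset.univ.filter fun i => i.val < a

/-- `min {T_i | i = a+1, …, A}`. -/
def minOtherExplosion (a : ℕ) (σ : Fin A → ℕ → ℝ) (x₀ : Fin A → ℕ) : ℝ≥0∞ :=
  ⨅ i : Fin A, ⨅ _ : a ≤ i.val, explosionTime (σ i) (x₀ i)

/-! ### Probabilistic quantities

Here `τ ω i k` is the sojourn time of agent `i` in state `k`. -/

variable {Ω : Type*} [MeasurableSpace Ω]

/-- The event that none of the first `a` agents is the monopolist. -/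
def allLose (a : ℕ) (τ : Ω → Fin A → ℕ → ℝ) (x₀ : Fin A → ℕ) : Set Ω :=
  {ω | ∀ i ∈ firstAgents A a, ¬ StrongMonopoly (τ ω) x₀ i}

/-- `P(B | E) = P(B ∩ E) / P(E)`. -/
def condProb (P : Measure Ω) (E B : Set Ω) : ℝ :=
  P.real (B ∩ E) / P.real E

/-- `P(T_i ≤ t)`. -/
def explosionCdf (P : Measure Ω) (τ : Ω → Fin A → ℕ → ℝ) (x₀ : Fin A → ℕ) (i : Fin A)
    (t : ℝ) : ℝ :=
  P.real {ω | explosionTime (τ ω i) (x₀ i) ≤ ENNReal.ofReal t}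

/-- `g_i(t) = d/dt P(T_i ≤ t)`. -/
def explosionDensity (P : Measure Ω) (τ : Ω → Fin A → ℕ → ℝ) (x₀ : Fin A → ℕ) (i : Fin A)
    (t : ℝ) : ℝ :=
  deriv (explosionCdf P τ x₀ i) t

/-- `G_i(t) = P(T_i > t)`. -/
def explosionSurvival (P : Measure Ω) (τ : Ω → Fin A → ℕ → ℝ) (x₀ : Fin A → ℕ) (i : Fin A)
    (t : ℝ) : ℝ :=
  P.real {ω | ENNReal.ofReal t < explosionTime (τ ω i) (x₀ i)}

/-- The random variable `∏_{i=1}^a g_i(S)`, with `S = min {T_i | i = a+1, …, A}`. -/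
def minIntegrand (P : Measure Ω) (a : ℕ) (τ : Ω → Fin A → ℕ → ℝ) (x₀ : Fin A → ℕ)
    (ω : Ω) : ℝ :=
  ∏ i ∈ firstAgents A a, explosionDensity P τ x₀ i (minOtherExplosion a (τ ω) x₀).toReal

/-- The random variable `(∏_{j ≤ a, j ≠ i} G_j(S)) g_i(S)`. -/
def maxIntegrand (P : Measure Ω) (a : ℕ) (τ : Ω → Fin A → ℕ → ℝ) (x₀ : Fin A → ℕ)
    (i : Fin A) (ω : Ω) : ℝ :=
  (∏ j ∈ (firstAgents A a).erase i,
      explosionSurvival P τ x₀ j (minOtherExplosion a (τ ω) x₀).toReal) *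
    explosionDensity P τ x₀ i (minOtherExplosion a (τ ω) x₀).toReal

end PolyaUrn

end

/-! The urn sees the birth processes only up to the first explosion time, because its jump times
increase to that time and never reach it. Hence an agent's limit exceeds `x` iff its jump out of `x`
happens before the first explosion (`lt_urnLimit_iff`). Almost surely there are no ties, so the
first `a` agents all lose iff `T_i > S` for each of them (`forall_not_strongMonopoly_iff`). On that
event the first explosion is `S`, which is independent of the first `a` rows. Given `S = t`, the
agents therefore decouple, and everything reduces to `gapProb`: the probability that the `n`-th
partial sum of one row is below `t` while its total time exceeds `t`.

The core is the one-row limit `ExpRow.tendsto_gapProb_div`: `gapProb` at `n`, divided by the tail of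
the mean sojourn times from `n` on, tends to the density of the total time at `t`. By the forward
equation, the probability of sitting in the `k`-th state at time `t` is the density at `t` of the
next jump time divided by the rate `l k`. These densities are averages of the density of the first
sojourn time, so they are at most `l 0` and converge to the density of the total time. Summing over
`k ≥ n` gives a weighted mean of a convergent sequence. The bound `l 0` is uniform in `t`, so
dominated convergence allows integration over `S`.

For the minimum the conditional probabilities multiply. For the maximum, the union of the exceedance
events lies between the disjoint events "only `i` exceeds" and the union bound; both sums have the
same first order, as a second exceedance costs another factor tending to `0`. For the sum, one big
term dominates: a sum above `x` forces one limit above `(1 - η) x` or two above `η x / a`. Regular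
variation makes the latter negligible and lets `η` tend to `0`. All limiting constants are strictly
positive, so the limits can be stated as quotients tending to `1`. -/

namespace PolyaUrn

/-! ### Independence -/

section Independence

variable {Ω : Type*} [MeasurableSpace Ω] {P : Measure Ω}

/-- The index sets may be infinite, as is needed to separate the first sojourn time from all later
ones. The product σ-algebra pulls back to the supremum of the σ-algebras of its coordinates. -/
theorem indepFun_restrict_of_disjoint {ι : Type*} {β : ι → Type*} {m : ∀ i, MeasurableSpace (β i)}
    {X : ∀ i, Ω → β i} (hX : ∀ i, Measurable (X i)) (h : iIndepFun X P) {S T : Set ι}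
    (hST : Disjoint S T) :
    IndepFun (fun ω (i : S) => X i ω) (fun ω (i : T) => X i ω) P := by
  rw [IndepFun_iff_Indep]
  have hind := indep_iSup_of_disjoint (fun i => (hX i).comap_le) h.iIndep hST
  have key : ∀ S : Set ι, MeasurableSpace.comap (fun ω (i : S) => X i ω) MeasurableSpace.pi
      = ⨆ i ∈ S, (m i).comap (X i) := by
    intro S
    simp [MeasurableSpace.pi, MeasurableSpace.comap_iSup, MeasurableSpace.comap_comp, iSup_subtype,
      Function.comp_def]
  rw [key, key]
  exact hind

/-- The joint law is an infinite product measure, and currying exhibits it as the product of the row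
laws. -/
theorem iIndepFun_rows {ι κ : Type*} {X : ι → κ → Ω → ℝ} (hX : ∀ i k, Measurable (X i k))
    (h : iIndepFun (fun p : ι × κ => X p.1 p.2) P) : iIndepFun (fun i ω k => X i k ω) P := by
  have := h.isProbabilityMeasure
  have hm : ∀ i k, IsProbabilityMeasure (P.map (X i k)) :=
    fun i k => Measure.isProbabilityMeasure_map (hX i k).aemeasurable
  have hrow : ∀ i, P.map (fun ω k => X i k ω) = Measure.infinitePi fun k => P.map (X i k) := by
    intro i
    refine iIndepFun.map_fun_eq_infinitePi_map (hX i) ?_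
    exact h.precomp (g := fun k => (i, k)) (fun a b hab => by simpa using hab)
  rw [iIndepFun_iff_map_fun_eq_infinitePi_map (fun i => measurable_pi_lambda _ (hX i))]
  simp_rw [hrow]
  rw [← Measure.infinitePi_map_curry (fun i k => P.map (X i k)),
    ← iIndepFun.map_fun_eq_infinitePi_map (fun p : ι × κ => hX p.1 p.2) h,
    Measure.map_map (f := fun ω (p : ι × κ) => X p.1 p.2 ω) (by fun_prop)
      (measurable_pi_lambda _ fun p => hX p.1 p.2)]
  rfl

/-- Fubini for the product law: `Y` may be frozen while `X` is resampled. This replaces conditioning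
on `S` later on. -/
theorem lintegral_section {α β : Type*} [MeasurableSpace α] [MeasurableSpace β]
    [IsProbabilityMeasure P] {X : Ω → α} {Y : Ω → β} (hX : Measurable X) (hY : Measurable Y)
    (h : IndepFun Y X P) {B : Set (β × α)} (hB : MeasurableSet B) :
    P {ω | (Y ω, X ω) ∈ B} = ∫⁻ ω, P {ω' | (Y ω, X ω') ∈ B} ∂P := by
  have hmap := (indepFun_iff_map_prod_eq_prod_map_map hY.aemeasurable hX.aemeasurable).1 h
  have : P {ω | (Y ω, X ω) ∈ B} = P.map (fun ω => (Y ω, X ω)) B :=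
    (Measure.map_apply (hY.prodMk hX) hB).symm
  have hXp := Measure.isProbabilityMeasure_map (μ := P) hX.aemeasurable
  rw [this, hmap, Measure.prod_apply hB, lintegral_map (measurable_measure_prodMk_left hB) hY]
  refine lintegral_congr fun ω => ?_
  rw [Measure.map_apply hX (measurable_prodMk_left hB)]
  rfl

theorem measurable_section {α β : Type*} [MeasurableSpace α] [MeasurableSpace β]
    [IsProbabilityMeasure P] {X : Ω → α} {Y : Ω → β} (hX : Measurable X) (hY : Measurable Y)
    {B : Set (β × α)} (hB : MeasurableSet B) :
    Measurable fun ω => P {ω' | (Y ω, X ω') ∈ B} := by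
  have hXp := Measure.isProbabilityMeasure_map (μ := P) hX.aemeasurable
  have : (fun ω => P {ω' | (Y ω, X ω') ∈ B}) = fun ω => P.map X (Prod.mk (Y ω) ⁻¹' B) := by
    ext ω
    rw [Measure.map_apply hX (measurable_prodMk_left hB)]
    rfl
  rw [this]
  exact (measurable_measure_prodMk_left hB).comp hY

theorem integral_section {α β : Type*} [MeasurableSpace α] [MeasurableSpace β]
    [IsProbabilityMeasure P] {X : Ω → α} {Y : Ω → β} (hX : Measurable X) (hY : Measurable Y)
    (h : IndepFun Y X P) {B : Set (β × α)} (hB : MeasurableSet B) :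
    P.real {ω | (Y ω, X ω) ∈ B} = ∫ ω, P.real {ω' | (Y ω, X ω') ∈ B} ∂P := by
  rw [measureReal_def, lintegral_section hX hY h hB]
  simp_rw [measureReal_def]
  rw [integral_toReal (measurable_section hX hY hB).aemeasurable
    (ae_of_all _ fun ω => measure_lt_top P _)]

theorem measure_eq_eq_zero_of_indepFun [IsProbabilityMeasure P] {X Y : Ω → ℝ} (hX : Measurable X)
    (hY : Measurable Y) (h : IndepFun X Y P) (hX0 : ∀ c, P {ω | X ω = c} = 0) :
    P {ω | X ω = Y ω} = 0 := by
  have hB : MeasurableSet {p : ℝ × ℝ | p.2 = p.1} := measurableSet_eq_fun measurable_snd measurable_fst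
  have := lintegral_section hX hY h.symm hB
  simp only [Set.mem_ofPred_eq, hX0, lintegral_zero] at this
  exact this

theorem measure_add_eq_zero_of_indepFun [IsProbabilityMeasure P] {X Y : Ω → ℝ} (hX : Measurable X)
    (hY : Measurable Y) (h : IndepFun X Y P) (hX0 : ∀ c, P {ω | X ω = c} = 0) (c : ℝ) :
    P {ω | X ω + Y ω = c} = 0 := by
  have := measure_eq_eq_zero_of_indepFun (Y := fun ω => c - Y ω) hX (by fun_prop)
    (h.comp (φ := id) (ψ := fun y => c - y) measurable_id (by fun_prop)) hX0
  simpa only [eq_sub_iff_add_eq] using this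

end Independence

/-! ### The exponential distribution -/

section Exponential

/-- The distribution function of the exponential law with rate `r`. -/
noncomputable def expCdf (r y : ℝ) : ℝ := 1 - Real.exp (-(r * max y 0))

/-- The density of the exponential law with rate `r`, with the value `0` at `0`. -/
noncomputable def expDensity (r y : ℝ) : ℝ := if 0 < y then r * Real.exp (-(r * y)) else 0

/-- The differential equation of the exponential law, which becomes the forward equation after
averaging. The value `0` of the density at `0` makes it hold at every point. -/
theorem expDensity_eq (r y : ℝ) :
    expDensity r y = r * (Set.indicator (Set.Ioi 0) 1 y - expCdf r y) := by
  unfold expDensity expCdf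
  split_ifs with h
  · simp [h, h.le]
  · simp [h, not_lt.1 h]

theorem measurable_expDensity (r : ℝ) : Measurable (expDensity r) :=
  Measurable.ite measurableSet_Ioi (by fun_prop) measurable_const

theorem measurable_expCdf (r : ℝ) : Measurable (expCdf r) := by
  unfold expCdf; fun_prop

theorem expDensity_nonneg {r : ℝ} (hr : 0 < r) (y : ℝ) : 0 ≤ expDensity r y := by
  unfold expDensity; split_ifs <;> positivity

theorem expDensity_le {r : ℝ} (hr : 0 < r) (y : ℝ) : expDensity r y ≤ r := by
  unfold expDensity
  split_ifs with h
  · have : Real.exp (-(r * y)) ≤ 1 := Real.exp_le_one_iff.2 (by nlinarith)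
    nlinarith
  · exact hr.le

theorem expCdf_nonneg {r : ℝ} (hr : 0 < r) (y : ℝ) : 0 ≤ expCdf r y := by
  unfold expCdf
  have : Real.exp (-(r * max y 0)) ≤ 1 :=
    Real.exp_le_one_iff.2 (by have := le_max_right y 0; nlinarith)
  linarith

theorem expCdf_le_one (r y : ℝ) : expCdf r y ≤ 1 := by
  unfold expCdf
  have := Real.exp_pos (-(r * max y 0))
  linarith

theorem continuousAt_expDensity (r : ℝ) {y : ℝ} (hy : y ≠ 0) : ContinuousAt (expDensity r) y := by
  rcases lt_or_gt_of_ne hy with h | h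
  · refine (continuousAt_const (y := (0 : ℝ))).congr ?_
    filter_upwards [eventually_lt_nhds h] with z hz
    simp [expDensity, hz.le]
  · have : ContinuousAt (fun y => r * Real.exp (-(r * y))) y := by fun_prop
    refine this.congr ?_
    filter_upwards [eventually_gt_nhds h] with z hz
    simp [expDensity, hz]

theorem hasDerivAt_expCdf (r : ℝ) {y : ℝ} (hy : y ≠ 0) :
    HasDerivAt (expCdf r) (expDensity r y) y := by
  rcases lt_or_gt_of_ne hy with h | h
  · have h0 : expDensity r y = 0 := by simp [expDensity, h.le]
    rw [h0]
    refine (hasDerivAt_const y (0 : ℝ)).congr_of_eventuallyEq ?_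
    filter_upwards [eventually_lt_nhds h] with z hz
    simp [expCdf, hz.le]
  · have h0 : expDensity r y = r * Real.exp (-(r * y)) := by simp [expDensity, h]
    rw [h0]
    refine ((hasDerivAt_neg_exp_mul_exp (r := r) (x := y)).const_add 1).congr_of_eventuallyEq ?_
    filter_upwards [eventually_gt_nhds h] with z hz
    simp [expCdf, hz.le, sub_eq_add_neg]

/-- The distribution function has a kink at `0`; the Lipschitz bound is what permits differentiation
under the integral sign nevertheless. -/
theorem lipschitzWith_expCdf {r : ℝ} (hr : 0 < r) : LipschitzWith (Real.nnabs r) (expCdf r) := by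
  have key : ∀ x y : ℝ, x ≤ y → |expCdf r x - expCdf r y| ≤ r * (y - x) := by
    intro x y hxy
    unfold expCdf
    have h1 : max x 0 ≤ max y 0 := max_le_max_right 0 hxy
    have h2 : max y 0 - max x 0 ≤ y - x := by
      rcases le_total x 0 with hx | hx <;> rcases le_total y 0 with hy | hy <;> simp [hx, hy] <;>
        linarith
    have h3 : Real.exp (-(r * max x 0)) ≤ 1 :=
      Real.exp_le_one_iff.2 (by have := le_max_right x 0; nlinarith)
    have h4 : Real.exp (-(r * max y 0)) =
        Real.exp (-(r * max x 0)) * Real.exp (-(r * (max y 0 - max x 0))) := by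
      rw [← Real.exp_add]; congr 1; ring
    have h5 := Real.add_one_le_exp (-(r * (max y 0 - max x 0)))
    have h6 : Real.exp (-(r * (max y 0 - max x 0))) ≤ 1 :=
      Real.exp_le_one_iff.2 (by nlinarith)
    have h7 := Real.exp_pos (-(r * max x 0))
    rw [abs_le, h4]
    have h8 : r * (max y 0 - max x 0) ≤ r * (y - x) := by gcongr
    constructor <;> nlinarith
  refine LipschitzWith.of_dist_le_mul fun x y => ?_
  simp only [Real.dist_eq, Real.coe_nnabs, abs_of_pos hr]
  rcases le_total x y with h | h
  · rw [abs_of_nonpos (sub_nonpos.2 h)]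
    linarith [key x y h]
  · rw [abs_of_nonneg (sub_nonneg.2 h), abs_sub_comm]
    exact key y x h

theorem expMeasure_real_Iic {r : ℝ} (hr : 0 < r) (y : ℝ) :
    (expMeasure r).real (Set.Iic y) = expCdf r y := by
  have := isProbabilityMeasure_expMeasure hr
  rw [← cdf_eq_real, cdf_expMeasure_eq hr, expCdf]
  split_ifs with h
  · simp [h]
  · simp [(not_le.1 h).le]

theorem lintegral_ofReal_expMeasure {r : ℝ} (hr : 0 < r) :
    ∫⁻ x, ENNReal.ofReal x ∂(expMeasure r) = ENNReal.ofReal (1 / r) := by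
  have hmeas : Measurable (gammaPDF 1 r) := (measurable_gammaPDFReal 1 r).ennreal_ofReal
  rw [expMeasure, gammaMeasure, lintegral_withDensity_eq_lintegral_mul _ hmeas
    ENNReal.measurable_ofReal]
  -- Multiplying the exponential density by `x` gives `1 / r` times a Gamma density of shape `2`,
  -- whose mass is `1`.
  have : ∀ x, (gammaPDF 1 r * fun x => ENNReal.ofReal x) x
      = ENNReal.ofReal (1 / r) * gammaPDF 2 r x := by
    intro x
    simp only [Pi.mul_apply, gammaPDF]
    rcases le_or_gt 0 x with hx | hx
    · rw [← ENNReal.ofReal_mul (gammaPDFReal_nonneg one_pos hr x), ← ENNReal.ofReal_mul (by positivity)]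
      congr 1
      simp only [gammaPDFReal, hx, if_true, Real.Gamma_one, Real.Gamma_two]
      norm_num
      field_simp
    · simp [gammaPDFReal, hx.not_ge]
  simp_rw [this]
  rw [lintegral_const_mul _ (show Measurable (gammaPDF 2 r) from
    (measurable_gammaPDFReal 2 r).ennreal_ofReal), lintegral_gammaPDF_eq_one two_pos hr, mul_one]

variable {Ω : Type*} [MeasurableSpace Ω] {P : Measure Ω}

theorem measure_eq_const_of_map_expMeasure {X : Ω → ℝ} {r : ℝ} (hX : Measurable X)
    (hlaw : P.map X = expMeasure r) (c : ℝ) : P {ω | X ω = c} = 0 := by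
  have : P {ω | X ω = c} = P.map X {c} := (Measure.map_apply hX (measurableSet_singleton c)).symm
  rw [this, hlaw, expMeasure, gammaMeasure]
  exact withDensity_absolutelyContinuous _ _ (measure_singleton c)

variable [IsProbabilityMeasure P]

theorem ae_pos_of_map_expMeasure {X : Ω → ℝ} {r : ℝ} (hr : 0 < r) (hX : Measurable X)
    (hlaw : P.map X = expMeasure r) : ∀ᵐ ω ∂P, 0 < X ω := by
  have h : P.real {ω | X ω ≤ 0} = 0 := by
    have : P.real {ω | X ω ≤ 0} = (P.map X).real (Set.Iic 0) := by
      rw [map_measureReal_apply hX measurableSet_Iic]; rfl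
    rw [this, hlaw, expMeasure_real_Iic hr]
    simp [expCdf]
  have h' := (measureReal_eq_zero_iff).1 h
  rw [ae_iff]
  simpa using h'

theorem measureReal_add_le {X Y : Ω → ℝ} {r : ℝ} (hr : 0 < r) (hX : Measurable X)
    (hY : Measurable Y) (h : IndepFun X Y P) (hlaw : P.map X = expMeasure r) (t : ℝ) :
    P.real {ω | X ω + Y ω ≤ t} = ∫ ω, expCdf r (t - Y ω) ∂P := by
  have hB : MeasurableSet {p : ℝ × ℝ | p.2 + p.1 ≤ t} :=
    measurableSet_le (measurable_snd.add measurable_fst) measurable_const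
  have := integral_section hX hY h.symm hB
  simp only [Set.mem_ofPred_eq] at this
  rw [this]
  refine integral_congr_ae (ae_of_all _ fun ω => ?_)
  simp only
  rw [← expMeasure_real_Iic hr, ← hlaw, map_measureReal_apply hX measurableSet_Iic]
  congr 1
  ext ω'
  simp [le_sub_iff_add_le]

theorem integrable_expCdf_sub {Y : Ω → ℝ} {r : ℝ} (hr : 0 < r) (hY : Measurable Y) (t : ℝ) :
    Integrable (fun ω => expCdf r (t - Y ω)) P :=
  Integrable.of_bound ((measurable_expCdf r).comp (by fun_prop)).aestronglyMeasurable 1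
    (ae_of_all _ fun ω => by
      rw [Real.norm_eq_abs, abs_of_nonneg (expCdf_nonneg hr _)]; exact expCdf_le_one r _)

/-- The distribution function of the sum of an exponential variable and an independent variable
without an atom at `t` is differentiable at `t`. -/
theorem hasDerivAt_measureReal_add_le {X Y : Ω → ℝ} {r : ℝ} (hr : 0 < r) (hX : Measurable X)
    (hY : Measurable Y) (h : IndepFun X Y P) (hlaw : P.map X = expMeasure r) {t : ℝ}
    (ht : P {ω | Y ω = t} = 0) :
    HasDerivAt (fun s => P.real {ω | X ω + Y ω ≤ s}) (∫ ω, expDensity r (t - Y ω) ∂P) t := by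
  simp_rw [measureReal_add_le hr hX hY h hlaw]
  refine (hasDerivAt_integral_of_dominated_loc_of_lip (F := fun s ω => expCdf r (s - Y ω))
    (bound := fun _ => r) univ_mem ?_ (integrable_expCdf_sub hr hY t) ?_ ?_
    (integrable_const r) ?_).2
  · exact Eventually.of_forall fun s =>
      ((measurable_expCdf r).comp (by fun_prop)).aestronglyMeasurable
  · exact ((measurable_expDensity r).comp (by fun_prop)).aestronglyMeasurable
  · refine ae_of_all _ fun ω => ?_
    have := (lipschitzWith_expCdf hr).comp (LipschitzWith.id.sub (LipschitzWith.const (Y ω)))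
    simpa [Function.comp_def] using this
  -- The kink is met only where `Y = t`, a null set.
  · have : ∀ᵐ ω ∂P, Y ω ≠ t := by rw [ae_iff]; simpa using ht
    filter_upwards [this] with ω hω
    exact (hasDerivAt_expCdf r (sub_ne_zero.2 (Ne.symm hω))).comp_sub_const t (Y ω)

theorem integral_expDensity_eq {X Y : Ω → ℝ} {r : ℝ} (hr : 0 < r) (hX : Measurable X)
    (hY : Measurable Y) (h : IndepFun X Y P) (hlaw : P.map X = expMeasure r) (t : ℝ) :
    ∫ ω, expDensity r (t - Y ω) ∂P =
      r * (P.real {ω | Y ω < t} - P.real {ω | X ω + Y ω ≤ t}) := by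
  simp_rw [expDensity_eq]
  have hset : MeasurableSet {ω | Y ω < t} := hY measurableSet_Iio
  have hind : (fun ω => Set.indicator (Set.Ioi (0 : ℝ)) (1 : ℝ → ℝ) (t - Y ω))
      = Set.indicator {ω | Y ω < t} 1 := by
    ext ω
    simp [Set.indicator_apply]
  rw [integral_const_mul, integral_sub _ (integrable_expCdf_sub hr hY t),
    measureReal_add_le hr hX hY h hlaw, hind, integral_indicator_one hset]
  rw [hind]
  exact (integrable_const (1 : ℝ)).indicator hset

end Exponential

/-! ### Sums of independent exponential variables -/

section Row

variable {Ω : Type*}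

/-- The sum of the first `n` variables. -/
def partialSum (ξ : ℕ → Ω → ℝ) (n : ℕ) (ω : Ω) : ℝ := ∑ k ∈ Finset.range n, ξ k ω

/-- The sum of all variables, with values in `[0, ∞]`. -/
noncomputable def totalTime (ξ : ℕ → Ω → ℝ) (ω : Ω) : ℝ≥0∞ := ∑' k, ENNReal.ofReal (ξ k ω)

/-- The sum of all variables but the first, as a real number. -/
noncomputable def tailTime (ξ : ℕ → Ω → ℝ) (ω : Ω) : ℝ := (totalTime (fun k => ξ (k + 1)) ω).toReal

theorem partialSum_succ (ξ : ℕ → Ω → ℝ) (n : ℕ) (ω : Ω) :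
    partialSum ξ (n + 1) ω = ξ n ω + partialSum ξ n ω := by
  rw [partialSum, Finset.sum_range_succ, add_comm]; rfl

theorem partialSum_succ' (ξ : ℕ → Ω → ℝ) (n : ℕ) (ω : Ω) :
    partialSum ξ (n + 1) ω = ξ 0 ω + partialSum (fun k => ξ (k + 1)) n ω := by
  rw [partialSum, Finset.sum_range_succ', add_comm]; rfl

variable {ξ : ℕ → Ω → ℝ} {l : ℕ → ℝ} {ω : Ω}

theorem totalTime_eq_add (hω : ∀ k, 0 < ξ k ω) (n : ℕ) :
    totalTime ξ ω = ENNReal.ofReal (partialSum ξ n ω) + totalTime (fun k => ξ (k + n)) ω := by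
  rw [totalTime, partialSum, ENNReal.ofReal_sum_of_nonneg fun k _ => (hω k).le]
  exact (ENNReal.summable.sum_add_tsum_nat_add' (f := fun k => ENNReal.ofReal (ξ k ω)) (k := n)).symm

theorem partialSum_nonneg (hω : ∀ k, 0 < ξ k ω) (n : ℕ) : 0 ≤ partialSum ξ n ω :=
  Finset.sum_nonneg fun k _ => (hω k).le

theorem totalTime_pos (hω : ∀ k, 0 < ξ k ω) : 0 < totalTime ξ ω :=
  (ENNReal.ofReal_pos.2 (hω 0)).trans_le (ENNReal.le_tsum 0)

theorem ofReal_partialSum_lt_totalTime (hω : ∀ k, 0 < ξ k ω) (n : ℕ) :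
    ENNReal.ofReal (partialSum ξ n ω) < totalTime ξ ω := by
  rw [totalTime_eq_add hω n]
  exact ENNReal.lt_add_right ENNReal.ofReal_ne_top (totalTime_pos fun k => hω (k + n)).ne'

theorem toReal_totalTime_eq (hω : ∀ k, 0 < ξ k ω) (ht : totalTime ξ ω < ∞) :
    (totalTime ξ ω).toReal = ξ 0 ω + tailTime ξ ω := by
  have h1 := totalTime_eq_add hω 1
  have h2 : totalTime (fun k => ξ (k + 1)) ω ≠ ∞ := by
    intro h; rw [h1, h] at ht; simp at ht
  rw [h1, ENNReal.toReal_add ENNReal.ofReal_ne_top h2,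
    ENNReal.toReal_ofReal (partialSum_nonneg hω 1), tailTime]
  simp [partialSum]

theorem tendsto_partialSum (hω : ∀ k, 0 < ξ k ω) (ht : totalTime ξ ω < ∞) :
    Tendsto (fun n => partialSum ξ n ω) atTop (𝓝 (totalTime ξ ω).toReal) := by
  have h1 := (ENNReal.tendsto_toReal ht.ne).comp
    (ENNReal.tendsto_nat_tsum fun k => ENNReal.ofReal (ξ k ω))
  refine h1.congr fun n => ?_
  simp only [Function.comp]
  rw [← ENNReal.ofReal_sum_of_nonneg fun k _ => (hω k).le,
    ENNReal.toReal_ofReal (Finset.sum_nonneg fun k _ => (hω k).le)]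
  rfl


variable [MeasurableSpace Ω] {P : Measure Ω}

/-- Independent exponential variables with rates `l n`. -/
structure ExpRow (P : Measure Ω) (ξ : ℕ → Ω → ℝ) (l : ℕ → ℝ) : Prop where
  rate_pos : ∀ n, 0 < l n
  meas : ∀ n, Measurable (ξ n)
  law : ∀ n, P.map (ξ n) = expMeasure (l n)
  indep : iIndepFun ξ P

theorem ExpRow.shift (h : ExpRow P ξ l) (m : ℕ) :
    ExpRow P (fun k => ξ (k + m)) (fun k => l (k + m)) where
  rate_pos _ := h.rate_pos _
  meas _ := h.meas _
  law _ := h.law _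
  indep := h.indep.precomp (add_left_injective m)

theorem ExpRow.measurable_partialSum (h : ExpRow P ξ l) (n : ℕ) : Measurable (partialSum ξ n) :=
  Finset.measurable_fun_sum _ fun k _ => h.meas k

theorem ExpRow.measurable_totalTime (h : ExpRow P ξ l) : Measurable (totalTime ξ) :=
  Measurable.tsum fun k => (h.meas k).ennreal_ofReal

theorem ExpRow.measurable_tailTime (h : ExpRow P ξ l) : Measurable (tailTime ξ) :=
  (h.shift 1).measurable_totalTime.ennreal_toReal

theorem ExpRow.indepFun_partialSum (h : ExpRow P ξ l) (n : ℕ) :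
    IndepFun (ξ n) (partialSum ξ n) P := by
  have := h.indep.indepFun_finsetSum_of_notMem h.meas (s := Finset.range n) (i := n) (by simp)
  have heq : partialSum ξ n = ∑ j ∈ Finset.range n, ξ j := by
    ext ω; simp [partialSum]
  rw [heq]
  exact this.symm

theorem ExpRow.indepFun_zero_shift (h : ExpRow P ξ l) :
    IndepFun (ξ 0) (fun ω (k : ℕ) => ξ (k + 1) ω) P := by
  have := indepFun_restrict_of_disjoint h.meas h.indep (S := {0}) (T := {0}ᶜ)
    disjoint_compl_right
  exact this.comp (φ := fun f : ({0} : Set ℕ) → ℝ => f ⟨0, rfl⟩)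
    (ψ := fun (f : ({0}ᶜ : Set ℕ) → ℝ) (k : ℕ) => f ⟨k + 1, Nat.succ_ne_zero k⟩)
    (measurable_pi_apply _) (measurable_pi_lambda _ fun _ => measurable_pi_apply _)

theorem ExpRow.indepFun_tailTime (h : ExpRow P ξ l) : IndepFun (ξ 0) (tailTime ξ) P := by
  refine h.indepFun_zero_shift.comp (φ := id)
    (ψ := fun f : ℕ → ℝ => (∑' k, ENNReal.ofReal (f k)).toReal) measurable_id ?_
  exact (Measurable.tsum fun k => (measurable_pi_apply k).ennreal_ofReal).ennreal_toReal

theorem ExpRow.indepFun_zero_partialSum_shift (h : ExpRow P ξ l) (n : ℕ) :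
    IndepFun (ξ 0) (partialSum (fun k => ξ (k + 1)) n) P :=
  h.indepFun_zero_shift.comp (φ := id) (ψ := fun f : ℕ → ℝ => ∑ k ∈ Finset.range n, f k)
    measurable_id (by fun_prop)

theorem ExpRow.lintegral_totalTime (h : ExpRow P ξ l) :
    ∫⁻ ω, totalTime ξ ω ∂P = ∑' k, ENNReal.ofReal (1 / l k) := by
  simp only [totalTime]
  rw [lintegral_tsum fun k => (h.meas k).ennreal_ofReal.aemeasurable]
  congr 1 with k
  rw [← lintegral_ofReal_expMeasure (h.rate_pos k), ← h.law k,
    lintegral_map ENNReal.measurable_ofReal (h.meas k)]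

theorem ExpRow.lintegral_totalTime_eq_ofReal (h : ExpRow P ξ l) (hs : Summable fun k => 1 / l k) :
    ∫⁻ ω, totalTime ξ ω ∂P = ENNReal.ofReal (∑' k, 1 / l k) := by
  rw [h.lintegral_totalTime, ENNReal.ofReal_tsum_of_nonneg
    (fun k => (one_div_pos.2 (h.rate_pos k)).le) hs]

theorem ExpRow.ae_totalTime_lt_top (h : ExpRow P ξ l) (hs : Summable fun k => 1 / l k) :
    ∀ᵐ ω ∂P, totalTime ξ ω < ∞ :=
  ae_lt_top h.measurable_totalTime (by
    rw [h.lintegral_totalTime_eq_ofReal hs]; exact ENNReal.ofReal_ne_top)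

theorem ExpRow.measure_partialSum_eq [IsProbabilityMeasure P] (h : ExpRow P ξ l) {n : ℕ}
    (hn : n ≠ 0) (c : ℝ) : P {ω | partialSum ξ n ω = c} = 0 := by
  obtain ⟨n, rfl⟩ := Nat.exists_eq_succ_of_ne_zero hn
  simp_rw [Nat.succ_eq_add_one, partialSum_succ]
  exact measure_add_eq_zero_of_indepFun (h.meas n) (h.measurable_partialSum n)
    (h.indepFun_partialSum n) (measure_eq_const_of_map_expMeasure (h.meas n) (h.law n)) c

theorem ExpRow.ae_pos [IsProbabilityMeasure P] (h : ExpRow P ξ l) : ∀ᵐ ω ∂P, ∀ k, 0 < ξ k ω :=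
  ae_all_iff.2 fun k => ae_pos_of_map_expMeasure (h.rate_pos k) (h.meas k) (h.law k)

theorem summable_one_div_shift (hs : Summable fun k => 1 / l k) (m : ℕ) :
    Summable fun k => 1 / l (k + m) :=
  (summable_nat_add_iff m (f := fun k => 1 / l k)).2 hs

theorem integral_expDensity_nonneg {r : ℝ} (hr : 0 < r) (Y : Ω → ℝ) (t : ℝ) :
    0 ≤ ∫ ω, expDensity r (t - Y ω) ∂P :=
  integral_nonneg fun _ => expDensity_nonneg hr _

theorem measureReal_lt_eq_le {Y : Ω → ℝ} {t : ℝ} (h : P {ω | Y ω = t} = 0) :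
    P.real {ω | Y ω < t} = P.real {ω | Y ω ≤ t} := by
  refine measureReal_congr ?_
  have : ∀ᵐ ω ∂P, Y ω ≠ t := by rw [ae_iff]; simpa using h
  filter_upwards [this] with ω hω
  exact propext (lt_iff_le_and_ne.trans (and_iff_left hω))

theorem ExpRow.measurableSet_gap (h : ExpRow P ξ l) (t : ℝ) :
    MeasurableSet {ω | ENNReal.ofReal t < totalTime ξ ω} :=
  measurableSet_lt measurable_const h.measurable_totalTime

theorem ExpRow.tsum_pos (h : ExpRow P ξ l) (hs : Summable fun k => 1 / l k) (n : ℕ) :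
    0 < ∑' k, 1 / l (k + n) :=
  (summable_one_div_shift hs n).tsum_pos (fun _ => (one_div_pos.2 (h.rate_pos _)).le) 0
    (one_div_pos.2 (h.rate_pos _))

variable [IsProbabilityMeasure P]

theorem ExpRow.ae_toReal_totalTime_eq (h : ExpRow P ξ l) (hs : Summable fun k => 1 / l k) :
    ∀ᵐ ω ∂P, (totalTime ξ ω).toReal = ξ 0 ω + tailTime ξ ω := by
  filter_upwards [h.ae_pos, h.ae_totalTime_lt_top hs] with ω h1 h2 using toReal_totalTime_eq h1 h2

theorem ExpRow.measure_toReal_totalTime_eq (h : ExpRow P ξ l) (hs : Summable fun k => 1 / l k)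
    (c : ℝ) : P {ω | (totalTime ξ ω).toReal = c} = 0 := by
  rw [← measure_add_eq_zero_of_indepFun (h.meas 0) h.measurable_tailTime h.indepFun_tailTime
    (measure_eq_const_of_map_expMeasure (h.meas 0) (h.law 0)) c]
  refine measure_congr ?_
  filter_upwards [h.ae_toReal_totalTime_eq hs] with ω hω
  exact congrArg (· = c) hω

theorem ExpRow.measure_tailTime_eq (h : ExpRow P ξ l) (hs : Summable fun k => 1 / l k) (c : ℝ) :
    P {ω | tailTime ξ ω = c} = 0 :=
  (h.shift 1).measure_toReal_totalTime_eq (summable_one_div_shift hs 1) c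

/-- The density of the total time. -/
noncomputable def totalDensity (P : Measure Ω) (ξ : ℕ → Ω → ℝ) (l : ℕ → ℝ) (t : ℝ) : ℝ :=
  ∫ ω, expDensity (l 0) (t - tailTime ξ ω) ∂P

theorem ExpRow.hasDerivAt_totalTime (h : ExpRow P ξ l) (hs : Summable fun k => 1 / l k) {t : ℝ}
    (ht : 0 < t) :
    HasDerivAt (fun s => P.real {ω | totalTime ξ ω ≤ ENNReal.ofReal s}) (totalDensity P ξ l t) t := by
  refine (hasDerivAt_measureReal_add_le (h.rate_pos 0) (h.meas 0) h.measurable_tailTime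
    h.indepFun_tailTime (h.law 0) (h.measure_tailTime_eq hs t)).congr_of_eventuallyEq ?_
  filter_upwards [eventually_gt_nhds ht] with s hs0
  refine measureReal_congr ?_
  filter_upwards [h.ae_toReal_totalTime_eq hs, h.ae_totalTime_lt_top hs] with ω h1 h2
  refine propext ?_
  change totalTime ξ ω ≤ ENNReal.ofReal s ↔ ξ 0 ω + tailTime ξ ω ≤ s
  rw [← h1, ENNReal.le_ofReal_iff_toReal_le h2.ne hs0.le]

/-- The density of the sum of the first `n + 1` variables, for `n ≠ 0`. -/
noncomputable def stepDensity (P : Measure Ω) (ξ : ℕ → Ω → ℝ) (l : ℕ → ℝ) (n : ℕ) (t : ℝ) : ℝ :=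
  ∫ ω, expDensity (l 0) (t - partialSum (fun k => ξ (k + 1)) n ω) ∂P

theorem integrable_expDensity_sub {Y : Ω → ℝ} {r : ℝ} (hr : 0 < r) (hY : Measurable Y) (t : ℝ) :
    Integrable (fun ω => expDensity r (t - Y ω)) P :=
  Integrable.of_bound ((measurable_expDensity r).comp (by fun_prop)).aestronglyMeasurable r
    (ae_of_all _ fun ω => by
      rw [Real.norm_eq_abs, abs_of_nonneg (expDensity_nonneg hr _)]; exact expDensity_le hr _)

theorem integral_expDensity_le {Y : Ω → ℝ} {r : ℝ} (hr : 0 < r) (hY : Measurable Y) (t : ℝ) :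
    ∫ ω, expDensity r (t - Y ω) ∂P ≤ r := by
  have := integral_mono (integrable_expDensity_sub hr hY t) (integrable_const r)
    (fun ω => expDensity_le hr (t - Y ω)) (μ := P)
  simpa using this

/-- Kolmogorov's forward equation. -/
theorem ExpRow.stepDensity_eq (h : ExpRow P ξ l) {n : ℕ} (hn : n ≠ 0) (t : ℝ) :
    stepDensity P ξ l n t =
      l n * (P.real {ω | partialSum ξ n ω < t} - P.real {ω | partialSum ξ (n + 1) ω < t}) := by
  -- The distribution function of the sum of `n + 1` variables is differentiated in two ways:
  -- splitting off `ξ 0` gives `stepDensity`, splitting off `ξ n` gives the right-hand side. Both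
  -- partial sums left over are nonempty, hence without atoms.
  have h1 := hasDerivAt_measureReal_add_le (h.rate_pos 0) (h.meas 0)
    ((h.shift 1).measurable_partialSum n) (h.indepFun_zero_partialSum_shift n) (h.law 0)
    ((h.shift 1).measure_partialSum_eq hn t)
  have h2 := hasDerivAt_measureReal_add_le (h.rate_pos n) (h.meas n)
    (h.measurable_partialSum n) (h.indepFun_partialSum n) (h.law n) (h.measure_partialSum_eq hn t)
  simp_rw [← partialSum_succ'] at h1
  simp_rw [← partialSum_succ] at h2
  rw [stepDensity, h1.unique h2, integral_expDensity_eq (h.rate_pos n) (h.meas n)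
    (h.measurable_partialSum n) (h.indepFun_partialSum n) (h.law n)]
  simp_rw [← partialSum_succ]
  rw [measureReal_lt_eq_le (h.measure_partialSum_eq n.succ_ne_zero t)]

/-- Since `ξ 0` is the variable split off, the integrand has the same rate `l 0` for all `n`, which
gives both the domination and the limit. The jump of the density at `0` matters only where the tail
time equals `t`. -/
theorem ExpRow.tendsto_stepDensity (h : ExpRow P ξ l) (hs : Summable fun k => 1 / l k) (t : ℝ) :
    Tendsto (fun n => stepDensity P ξ l n t) atTop (𝓝 (totalDensity P ξ l t)) := by
  refine tendsto_integral_of_dominated_convergence (fun _ => l 0) (fun n => ?_)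
    (integrable_const _) (fun n => ae_of_all _ fun ω => ?_) ?_
  · exact (integrable_expDensity_sub (h.rate_pos 0)
      ((h.shift 1).measurable_partialSum n) t).aestronglyMeasurable
  · rw [Real.norm_eq_abs, abs_of_nonneg (expDensity_nonneg (h.rate_pos 0) _)]
    exact expDensity_le (h.rate_pos 0) _
  · have hne : ∀ᵐ ω ∂P, tailTime ξ ω ≠ t := by
      rw [ae_iff]; simpa using h.measure_tailTime_eq hs t
    filter_upwards [hne, h.ae_pos,
      (h.shift 1).ae_totalTime_lt_top (summable_one_div_shift hs 1)] with ω h1 h2 h3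
    exact (continuousAt_expDensity (l 0) (sub_ne_zero.2 h1.symm)).tendsto.comp
      ((tendsto_partialSum (fun k => h2 (k + 1)) h3).const_sub t)

/-- The probability that `t` lies between the `n`-th partial sum and the total time. -/
noncomputable def gapProb (P : Measure Ω) (ξ : ℕ → Ω → ℝ) (n : ℕ) (t : ℝ) : ℝ :=
  P.real {ω | partialSum ξ n ω < t ∧ ENNReal.ofReal t < totalTime ξ ω}

theorem ExpRow.tendsto_gapProb_zero (h : ExpRow P ξ l) (hs : Summable fun k => 1 / l k) {t : ℝ}
    (ht : 0 < t) : Tendsto (fun n => gapProb P ξ n t) atTop (𝓝 0) := by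
  have := tendsto_measure_of_ae_tendsto_indicator_of_isFiniteMeasure (μ := P) (L := atTop)
    (As := fun n : ℕ => {ω | partialSum ξ n ω < t ∧ ENNReal.ofReal t < totalTime ξ ω})
    (A := ∅) MeasurableSet.empty
    (fun n => (measurableSet_lt (h.measurable_partialSum n) measurable_const).inter
      (h.measurableSet_gap t)) ?_
  · rw [measure_empty] at this
    simpa [gapProb, measureReal_def, Function.comp_def] using
      (ENNReal.tendsto_toReal ENNReal.zero_ne_top).comp this
  · filter_upwards [h.ae_pos, h.ae_totalTime_lt_top hs] with ω h1 h2
    by_cases hT : ENNReal.ofReal t < totalTime ξ ω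
    · have h3 : t < (totalTime ξ ω).toReal := (ENNReal.ofReal_lt_iff_lt_toReal ht.le h2.ne).1 hT
      filter_upwards [(tendsto_partialSum h1 h2).eventually (lt_mem_nhds h3)] with n hn
      simp [hn.le]
    · exact Eventually.of_forall fun n => by simp [hT]

/-- The gap probability is a difference of two distribution functions of which only the first
depends on `n`, so the forward equation applies. -/
theorem ExpRow.gapProb_sub (h : ExpRow P ξ l) {n : ℕ} (hn : n ≠ 0) {t : ℝ} (ht : 0 < t) :
    gapProb P ξ n t - gapProb P ξ (n + 1) t = stepDensity P ξ l n t / l n := by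
  have key : ∀ n, gapProb P ξ n t =
      P.real {ω | partialSum ξ n ω < t} - P.real {ω | totalTime ξ ω ≤ ENNReal.ofReal t} := by
    intro n
    have hms : MeasurableSet {ω | totalTime ξ ω ≤ ENNReal.ofReal t} :=
      measurableSet_le h.measurable_totalTime measurable_const
    have h1 := measureReal_sdiff_add_inter (μ := P) (s := {ω | partialSum ξ n ω < t}) hms
    have h2 : gapProb P ξ n t = P.real ({ω | partialSum ξ n ω < t} \
        {ω | totalTime ξ ω ≤ ENNReal.ofReal t}) := by
      unfold gapProb
      congr 1
      ext ω
      simp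
    -- Partial sums lie strictly below the total time, so a total time of at most `t` already forces
    -- the other condition.
    have h3 : P.real ({ω | partialSum ξ n ω < t} ∩ {ω | totalTime ξ ω ≤ ENNReal.ofReal t}) =
        P.real {ω | totalTime ξ ω ≤ ENNReal.ofReal t} := by
      refine measureReal_congr ?_
      filter_upwards [h.ae_pos] with ω hω
      refine propext (and_iff_right_of_imp fun hle => ?_)
      exact (ENNReal.ofReal_lt_ofReal_iff ht).1
        ((ofReal_partialSum_lt_totalTime hω n).trans_le hle)
    linarith
  rw [key, key, h.stepDensity_eq hn, mul_div_cancel_left₀ _ (h.rate_pos n).ne']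
  ring

theorem ExpRow.summable_stepDensity_div (h : ExpRow P ξ l) (hs : Summable fun k => 1 / l k) (n : ℕ)
    (t : ℝ) : Summable fun k => stepDensity P ξ l (k + n) t / l (k + n) := by
  refine Summable.of_nonneg_of_le (fun k => div_nonneg
    (integral_expDensity_nonneg (h.rate_pos 0) _ t) (h.rate_pos _).le) (fun k => ?_)
    ((summable_one_div_shift hs n).mul_left (l 0))
  rw [mul_one_div]
  exact div_le_div_of_nonneg_right (integral_expDensity_le (h.rate_pos 0)
    ((h.shift 1).measurable_partialSum _) t) (h.rate_pos _).le

theorem ExpRow.gapProb_eq_tsum (h : ExpRow P ξ l) (hs : Summable fun k => 1 / l k) {n : ℕ}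
    (hn : n ≠ 0) {t : ℝ} (ht : 0 < t) :
    gapProb P ξ n t = ∑' k, stepDensity P ξ l (k + n) t / l (k + n) := by
  have h1 := (h.summable_stepDensity_div hs n t).hasSum.tendsto_sum_nat
  refine tendsto_nhds_unique ?_ h1
  have h2 : ∀ m, ∑ k ∈ Finset.range m, stepDensity P ξ l (k + n) t / l (k + n) =
      gapProb P ξ n t - gapProb P ξ (m + n) t := by
    intro m
    rw [Finset.sum_congr rfl fun k _ => (h.gapProb_sub (n := k + n) (by omega) ht).symm]
    have := Finset.sum_range_sub' (fun k => gapProb P ξ (k + n) t) m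
    simp only [zero_add] at this
    rw [← this]
    refine Finset.sum_congr rfl fun k _ => ?_
    rw [add_right_comm]
  simp_rw [h2]
  have h3 := ((tendsto_add_atTop_iff_nat n).2 (h.tendsto_gapProb_zero hs ht)).const_sub
    (gapProb P ξ n t)
  simpa using h3

/-- Uniformity in `t` makes this the dominating bound when `t` is replaced by the random time `S`.
-/
theorem ExpRow.gapProb_le (h : ExpRow P ξ l) (hs : Summable fun k => 1 / l k) {n : ℕ}
    (hn : n ≠ 0) {t : ℝ} (ht : 0 < t) :
    gapProb P ξ n t ≤ l 0 * ∑' k, 1 / l (k + n) := by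
  rw [h.gapProb_eq_tsum hs hn ht, ← tsum_mul_left]
  refine (h.summable_stepDensity_div hs n t).tsum_le_tsum (fun k => ?_)
    ((summable_one_div_shift hs n).mul_left (l 0))
  rw [mul_one_div]
  exact div_le_div_of_nonneg_right (integral_expDensity_le (h.rate_pos 0)
    ((h.shift 1).measurable_partialSum _) t) (h.rate_pos _).le

/-- The quotient is the mean of the step densities with index at least `n`, weighted by `1 / l k`; a
mean of a tail of a convergent sequence has the same limit. -/
theorem ExpRow.tendsto_gapProb_div (h : ExpRow P ξ l) (hs : Summable fun k => 1 / l k) {t : ℝ}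
    (ht : 0 < t) :
    Tendsto (fun n => gapProb P ξ n t / ∑' k, 1 / l (k + n)) atTop
      (𝓝 (totalDensity P ξ l t)) := by
  rw [Metric.tendsto_atTop]
  intro ε hε
  obtain ⟨N, hN⟩ := Metric.tendsto_atTop.1 (h.tendsto_stepDensity hs t) (ε / 2) (half_pos hε)
  refine ⟨N + 1, fun n hn => ?_⟩
  set g := totalDensity P ξ l t
  have hr := h.tsum_pos hs n
  have hsr := summable_one_div_shift hs n
  have hsd := h.summable_stepDensity_div hs n t
  rw [h.gapProb_eq_tsum hs (by omega) ht, Real.dist_eq]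
  have hb : ∀ k, |stepDensity P ξ l (k + n) t - g| ≤ ε / 2 := fun k => by
    rw [← Real.dist_eq]; exact (hN (k + n) (by omega)).le
  have hpt : ∀ k, stepDensity P ξ l (k + n) t / l (k + n) ≤ (g + ε / 2) * (1 / l (k + n)) ∧
      (g - ε / 2) * (1 / l (k + n)) ≤ stepDensity P ξ l (k + n) t / l (k + n) := fun k => by
    have hl := h.rate_pos (k + n)
    have := abs_le.1 (hb k)
    rw [mul_one_div, mul_one_div]
    constructor <;> gcongr <;> linarith
  have h1 := hsd.tsum_le_tsum (fun k => (hpt k).1) (hsr.mul_left _)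
  have h2 := (hsr.mul_left _).tsum_le_tsum (fun k => (hpt k).2) hsd
  rw [tsum_mul_left] at h1 h2
  rw [← div_le_iff₀ hr] at h1
  rw [← le_div_iff₀ hr] at h2
  rw [abs_lt]
  constructor <;> linarith

theorem ExpRow.measure_totalTime_lt_of_tsum_lt (h : ExpRow P ξ l) (hs : Summable fun k => 1 / l k)
    {s : ℝ} (hlt : ∑' k, 1 / l k < s) : 0 < P {ω | totalTime ξ ω < ENNReal.ofReal s} := by
  rw [pos_iff_ne_zero]
  intro h0
  have hge : ∀ᵐ ω ∂P, ENNReal.ofReal s ≤ totalTime ξ ω := by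
    rw [ae_iff]; simpa using h0
  have := lintegral_mono_ae hge
  rw [h.lintegral_totalTime_eq_ofReal hs] at this
  simp only [lintegral_const, measure_univ, mul_one] at this
  have h0 : 0 ≤ ∑' k, 1 / l k := tsum_nonneg fun k => (one_div_pos.2 (h.rate_pos k)).le
  exact absurd ((ENNReal.ofReal_le_ofReal_iff h0).1 this) (not_le.2 hlt)

/-- The first variable is independent of the rest and at most `s' - s` with positive probability. -/
theorem ExpRow.measure_totalTime_lt_step (h : ExpRow P ξ l) {s s' : ℝ} (hs0 : 0 < s) (hss' : s < s')
    (hpos : 0 < P {ω | totalTime (fun k => ξ (k + 1)) ω < ENNReal.ofReal s}) :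
    0 < P {ω | totalTime ξ ω < ENNReal.ofReal s'} := by
  have hind := h.indepFun_zero_shift.comp (φ := id)
    (ψ := fun f : ℕ → ℝ => ∑' k, ENNReal.ofReal (f k)) measurable_id
    (Measurable.tsum fun k => (measurable_pi_apply k).ennreal_ofReal)
  have h1 := hind.measure_inter_preimage_eq_mul (Set.Iic (s' - s)) (Set.Iio (ENNReal.ofReal s))
    measurableSet_Iic measurableSet_Iio
  have h2 : 0 < P (id ∘ ξ 0 ⁻¹' Set.Iic (s' - s)) := by
    have : P (id ∘ ξ 0 ⁻¹' Set.Iic (s' - s)) = P.map (ξ 0) (Set.Iic (s' - s)) :=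
      (Measure.map_apply (h.meas 0) measurableSet_Iic).symm
    have hreal := expMeasure_real_Iic (h.rate_pos 0) (s' - s)
    rw [this, h.law 0]
    refine pos_iff_ne_zero.2 fun h0 => ?_
    rw [measureReal_def, h0, expCdf, max_eq_left (by linarith)] at hreal
    have : Real.exp (-(l 0 * (s' - s))) < 1 :=
      Real.exp_lt_one_iff.2 (by have := mul_pos (h.rate_pos 0) (sub_pos.2 hss'); linarith)
    simp only [ENNReal.toReal_zero] at hreal
    linarith
  have h3 := ENNReal.mul_pos h2.ne' (ne_of_gt hpos)
  refine (h3.trans_eq h1.symm).trans_le (measure_mono_ae ?_)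
  filter_upwards [h.ae_pos] with ω hω hmem
  obtain ⟨ha, hb⟩ := hmem
  change ξ 0 ω ≤ s' - s at ha
  change totalTime (fun k => ξ (k + 1)) ω < ENNReal.ofReal s at hb
  change totalTime ξ ω < ENNReal.ofReal s'
  rw [totalTime_eq_add hω 1]
  have hx : partialSum ξ 1 ω = ξ 0 ω := by simp [partialSum]
  rw [hx, show s' = (s' - s) + s by ring, ENNReal.ofReal_add (by linarith) hs0.le]
  exact ENNReal.add_lt_add_of_le_of_lt ENNReal.ofReal_ne_top (ENNReal.ofReal_le_ofReal ha) hb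

/-- Once finitely many variables are peeled off, the rest has mean below `s`, hence falls below `s`
with positive probability; the peeled variables are put back one at a time. -/
theorem ExpRow.measure_totalTime_lt_pos (h : ExpRow P ξ l) (hs : Summable fun k => 1 / l k) {s : ℝ}
    (hs0 : 0 < s) : 0 < P {ω | totalTime ξ ω < ENNReal.ofReal s} := by
  have key : ∀ (m : ℕ) {ξ : ℕ → Ω → ℝ} {l : ℕ → ℝ}, ExpRow P ξ l → (Summable fun k => 1 / l k) →
      ∀ s : ℝ, ∑' k, 1 / l (k + m) < s → 0 < P {ω | totalTime ξ ω < ENNReal.ofReal s} := by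
    intro m
    induction m with
    | zero => exact fun h hs s hlt => h.measure_totalTime_lt_of_tsum_lt hs hlt
    | succ m ih =>
      intro ξ l h hs s hlt
      obtain ⟨s₁, h1, h2⟩ := exists_between hlt
      refine h.measure_totalTime_lt_step ((h.tsum_pos hs _).trans h1) h2
        (ih (h.shift 1) (summable_one_div_shift hs 1) s₁ ?_)
      simpa only [add_assoc] using h1
  have ht := tendsto_sum_nat_add fun k => 1 / l k
  obtain ⟨m, hm⟩ := (ht.eventually_lt_const hs0).exists
  exact key m h hs s hm

theorem ExpRow.totalDensity_pos (h : ExpRow P ξ l) (hs : Summable fun k => 1 / l k) {t : ℝ}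
    (ht : 0 < t) : 0 < totalDensity P ξ l t := by
  rw [totalDensity, integral_pos_iff_support_of_nonneg
    (fun ω => expDensity_nonneg (h.rate_pos 0) _)
    (integrable_expDensity_sub (h.rate_pos 0) h.measurable_tailTime t)]
  refine ((h.shift 1).measure_totalTime_lt_pos (summable_one_div_shift hs 1) ht).trans_le
    (measure_mono fun ω hω => ?_)
  have hω' : tailTime ξ ω < t := by
    rw [tailTime]
    exact (ENNReal.lt_ofReal_iff_toReal_lt (ne_top_of_lt hω)).1 hω
  have hl := h.rate_pos 0
  rw [Function.mem_support, expDensity, if_pos (sub_pos.2 hω')]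
  positivity

theorem ExpRow.totalDensity_le (h : ExpRow P ξ l) (t : ℝ) : totalDensity P ξ l t ≤ l 0 :=
  integral_expDensity_le (h.rate_pos 0) h.measurable_tailTime t

theorem ExpRow.survival_pos (h : ExpRow P ξ l) {t : ℝ} (ht : 0 < t) :
    0 < P.real {ω | ENNReal.ofReal t < totalTime ξ ω} := by
  have h1 : 0 < P.real {ω | t < ξ 0 ω} := by
    have hc : {ω | t < ξ 0 ω} = (ξ 0 ⁻¹' Set.Iic t)ᶜ := by ext; simp
    rw [hc, probReal_compl_eq_one_sub (h.meas 0 measurableSet_Iic),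
      ← map_measureReal_apply (h.meas 0) measurableSet_Iic, h.law 0,
      expMeasure_real_Iic (h.rate_pos 0), expCdf]
    simpa using Real.exp_pos _
  refine h1.trans_le (measureReal_mono fun ω hω => ?_)
  exact ((ENNReal.ofReal_lt_ofReal_iff (ht.trans hω)).2 hω).trans_le (ENNReal.le_tsum 0)

end Row

/-! ### Paths of the birth processes and of the urn -/

section Paths

/-- The time of the jump of the birth process from `k` to `k + 1`. -/
def jumpSum (σ : ℕ → ℝ) (x₀ k : ℕ) : ℝ := ∑ l ∈ Finset.Icc x₀ k, σ l

/-! ### The path of a single birth process -/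

section OneAgent

variable {σ : ℕ → ℝ} {x₀ : ℕ}

theorem jumpSum_mono (hσ : ∀ k, 0 < σ (x₀ + k)) : Monotone (jumpSum σ x₀) := by
  intro k m hkm
  refine Finset.sum_le_sum_of_subset_of_nonneg (Finset.Icc_subset_Icc_right hkm) fun l hl _ => ?_
  obtain ⟨d, rfl⟩ := Nat.exists_eq_add_of_le (Finset.mem_Icc.1 hl).1
  exact (hσ d).le

theorem jumpSum_nonneg (hσ : ∀ k, 0 < σ (x₀ + k)) (k : ℕ) : 0 ≤ jumpSum σ x₀ k := by
  refine Finset.sum_nonneg fun l hl => ?_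
  obtain ⟨d, rfl⟩ := Nat.exists_eq_add_of_le (Finset.mem_Icc.1 hl).1
  exact (hσ d).le

theorem jumpSum_add (n : ℕ) :
    jumpSum σ x₀ (x₀ + n) = ∑ k ∈ Finset.range (n + 1), σ (x₀ + k) := by
  rw [jumpSum, ← Finset.Ico_add_one_right_eq_Icc, Finset.sum_Ico_eq_sum_range]
  congr 2
  omega

theorem birthProcess_le_iff (hσ : ∀ k, 0 < σ (x₀ + k)) (t : ℝ) (k : ℕ) :
    birthProcess σ x₀ t ≤ k ↔ t < jumpSum σ x₀ k := by
  rw [birthProcess, ← ENat.lt_natCast_add_one_iff, sInf_lt_iff]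
  constructor
  · rintro ⟨_, ⟨m, hm, rfl⟩, hlt⟩
    have hmk : m ≤ k := by
      rw [ENat.lt_natCast_add_one_iff] at hlt
      exact Nat.cast_le.1 hlt
    exact lt_of_lt_of_le hm (jumpSum_mono hσ hmk)
  · intro h
    exact ⟨k, ⟨k, h, rfl⟩, by exact_mod_cast Nat.lt_succ_self k⟩

theorem lt_birthProcess_iff (hσ : ∀ k, 0 < σ (x₀ + k)) (t : ℝ) (k : ℕ) :
    (k : ℕ∞) < birthProcess σ x₀ t ↔ jumpSum σ x₀ k ≤ t := by
  rw [← not_le, birthProcess_le_iff hσ, not_lt]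

theorem birthProcess_mono : Monotone (birthProcess σ x₀) := by
  intro s t hst
  exact sInf_le_sInf (Set.image_mono fun k hk => hst.trans_lt hk)

theorem ofReal_jumpSum_lt (hσ : ∀ k, 0 < σ (x₀ + k)) (k : ℕ) :
    ENNReal.ofReal (jumpSum σ x₀ k) < explosionTime σ x₀ := by
  refine lt_of_le_of_lt ?_ (ofReal_partialSum_lt_totalTime
    (ξ := fun k (σ : ℕ → ℝ) => σ (x₀ + k)) (ω := σ) hσ (k + 1))
  refine ENNReal.ofReal_le_ofReal ((jumpSum_mono hσ (Nat.le_add_left k x₀)).trans ?_)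
  rw [jumpSum_add]; rfl

theorem exists_lt_jumpSum (hσ : ∀ k, 0 < σ (x₀ + k)) {s : ℝ}
    (h : ENNReal.ofReal s < explosionTime σ x₀) : ∃ k, s < jumpSum σ x₀ k := by
  by_contra! hall
  refine absurd h (not_lt.2 (ENNReal.tsum_le_of_sum_range_le fun n => ?_))
  rw [← ENNReal.ofReal_sum_of_nonneg fun k _ => (hσ k).le]
  refine ENNReal.ofReal_le_ofReal (le_trans ?_ (hall (x₀ + n)))
  rw [jumpSum_add]
  exact Finset.sum_le_sum_of_subset_of_nonneg (Finset.range_subset_range.2 n.le_succ)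
    fun k _ _ => (hσ k).le

theorem exists_birthProcess_eq (hσ : ∀ k, 0 < σ (x₀ + k)) {s : ℝ}
    (h : ENNReal.ofReal s < explosionTime σ x₀) : ∃ k : ℕ, birthProcess σ x₀ s = k := by
  obtain ⟨k, hk⟩ := exists_lt_jumpSum hσ h
  have := (birthProcess_le_iff hσ s k).2 hk
  exact ⟨_, (ENat.natCast_toNat (ne_top_of_le_ne_top (ENat.natCast_ne_top k) this)).symm⟩

end OneAgent

theorem exists_eventually_const_of_monotone_of_le {f : ℕ → ℕ∞} (hf : Monotone f) {k : ℕ}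
    (hk : ∀ n, f n ≤ k) : ∃ N, ∀ n, N ≤ n → f n = f N := by
  have hfin : ∀ n, f n ≠ ⊤ := fun n => ne_top_of_le_ne_top (ENat.natCast_ne_top k) (hk n)
  have hb : BddAbove (Set.range fun n => (f n).toNat) := by
    refine ⟨k, ?_⟩
    rintro _ ⟨n, rfl⟩
    exact ENat.toNat_le_of_le_natCast (hk n)
  obtain ⟨N, hN⟩ := Nat.sSup_mem (Set.range_nonempty fun n => (f n).toNat) hb
  refine ⟨N, fun n hn => le_antisymm ?_ (hf hn)⟩
  rw [← ENat.natCast_toNat (hfin n), ← ENat.natCast_toNat (hfin N)]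
  have := le_csSup hb (Set.mem_range_self n)
  rw [← hN] at this
  exact_mod_cast this

variable {A : ℕ} {σ : Fin A → ℕ → ℝ} {x₀ : Fin A → ℕ}

/-- The first explosion time. -/
noncomputable def minExplosion (σ : Fin A → ℕ → ℝ) (x₀ : Fin A → ℕ) : ℝ≥0∞ :=
  ⨅ i, explosionTime (σ i) (x₀ i)

theorem exists_explosionTime_eq_minExplosion (hfin : minExplosion σ x₀ < ∞) :
    ∃ i, explosionTime (σ i) (x₀ i) = minExplosion σ x₀ := by
  have : Nonempty (Fin A) := by
    by_contra h
    rw [not_nonempty_iff] at h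
    simp [minExplosion] at hfin
  exact exists_eq_ciInf_of_finite

/-- Before the first explosion every process is in a finite state, so the times at which some state
has changed form a closed half-line starting at the earliest pending jump. The infimum is thus
attained, and it precedes the first explosion because the agent exploding first also has a pending
jump. -/
theorem nextJump (hσ : ∀ i k, 0 < σ i (x₀ i + k)) (hfin : minExplosion σ x₀ < ∞) {t : ℝ}
    (ht : ENNReal.ofReal t < minExplosion σ x₀) :
    let u := sInf {s : ℝ | t < s ∧ ∃ i, birthProcess (σ i) (x₀ i) s ≠ birthProcess (σ i) (x₀ i) t}
    t < u ∧ ENNReal.ofReal u < minExplosion σ x₀ ∧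
      ∃ i, birthProcess (σ i) (x₀ i) t < birthProcess (σ i) (x₀ i) u := by
  intro u
  choose k hk using fun i => exists_birthProcess_eq (hσ i) (ht.trans_le (iInf_le _ i))
  have hlt : ∀ i, t < jumpSum (σ i) (x₀ i) (k i) := fun i =>
    (birthProcess_le_iff (hσ i) t (k i)).1 (hk i).le
  obtain ⟨j, hj⟩ := exists_explosionTime_eq_minExplosion hfin
  have : Nonempty (Fin A) := ⟨j⟩
  obtain ⟨i₀, hi₀⟩ := Finite.exists_min fun i => jumpSum (σ i) (x₀ i) (k i)
  have hset : {s : ℝ | t < s ∧ ∃ i, birthProcess (σ i) (x₀ i) s ≠ birthProcess (σ i) (x₀ i) t} =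
      Set.Ici (jumpSum (σ i₀) (x₀ i₀) (k i₀)) := by
    ext s
    constructor
    · rintro ⟨hts, i, hne⟩
      have h1 := lt_of_le_of_ne (birthProcess_mono hts.le) hne.symm
      rw [hk i, lt_birthProcess_iff (hσ i)] at h1
      exact (hi₀ i).trans h1
    · intro hs
      refine ⟨(hlt i₀).trans_le hs, i₀, ne_of_gt ?_⟩
      rw [hk i₀, lt_birthProcess_iff (hσ i₀)]
      exact hs
  have hu : u = jumpSum (σ i₀) (x₀ i₀) (k i₀) := by
    change sInf _ = _
    rw [hset, csInf_Ici]
  refine ⟨hu ▸ hlt i₀, ?_, i₀, ?_⟩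
  · rw [hu, ← hj]
    exact (ENNReal.ofReal_le_ofReal (hi₀ j)).trans_lt (ofReal_jumpSum_lt (hσ j) (k j))
  · rw [hk i₀, lt_birthProcess_iff (hσ i₀), hu]

theorem minExplosion_pos (hσ : ∀ i k, 0 < σ i (x₀ i + k)) (hfin : minExplosion σ x₀ < ∞) :
    0 < minExplosion σ x₀ := by
  obtain ⟨j, hj⟩ := exists_explosionTime_eq_minExplosion hfin
  rw [← hj]
  exact zero_le.trans_lt (ofReal_jumpSum_lt (hσ j) 0)

theorem jumpTime_lt_minExplosion (hσ : ∀ i k, 0 < σ i (x₀ i + k)) (hfin : minExplosion σ x₀ < ∞)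
    (n : ℕ) : ENNReal.ofReal (jumpTime σ x₀ n) < minExplosion σ x₀ := by
  induction n with
  | zero => simpa [jumpTime] using minExplosion_pos hσ hfin
  | succ n ih => exact (nextJump hσ hfin ih).2.1

theorem jumpTime_strictMono (hσ : ∀ i k, 0 < σ i (x₀ i + k)) (hfin : minExplosion σ x₀ < ∞) :
    StrictMono (jumpTime σ x₀) :=
  strictMono_nat_of_lt_succ fun n => (nextJump hσ hfin (jumpTime_lt_minExplosion hσ hfin n)).1

theorem urn_mono (hσ : ∀ i k, 0 < σ i (x₀ i + k)) (hfin : minExplosion σ x₀ < ∞) (i : Fin A) :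
    Monotone fun n => urn σ x₀ n i :=
  birthProcess_mono.comp (jumpTime_strictMono hσ hfin).monotone

/-- Jump times cannot accumulate before the first explosion: at such a time all states are finite,
whereas the sum of the states grows by at least one per jump. -/
theorem exists_lt_jumpTime (hσ : ∀ i k, 0 < σ i (x₀ i + k)) (hfin : minExplosion σ x₀ < ∞) {s : ℝ}
    (hs : ENNReal.ofReal s < minExplosion σ x₀) : ∃ n, s < jumpTime σ x₀ n := by
  by_contra! hall
  choose k hk using fun i => exists_birthProcess_eq (hσ i) (hs.trans_le (iInf_le _ i))
  choose c hc using fun n i => exists_birthProcess_eq (hσ i)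
    ((jumpTime_lt_minExplosion hσ hfin n).trans_le (iInf_le _ i))
  have hck : ∀ n i, c n i ≤ k i := fun n i => by
    have := birthProcess_mono (σ := σ i) (x₀ := x₀ i) (hall n)
    rw [hc, hk] at this
    exact_mod_cast this
  have hmono : ∀ n i, c n i ≤ c (n + 1) i := fun n i => by
    have : birthProcess (σ i) (x₀ i) (jumpTime σ x₀ n) ≤
        birthProcess (σ i) (x₀ i) (jumpTime σ x₀ (n + 1)) := urn_mono hσ hfin i n.le_succ
    rw [hc, hc] at this
    exact_mod_cast this
  have hstep : StrictMono fun n => ∑ i, c n i := by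
    refine strictMono_nat_of_lt_succ fun n => ?_
    obtain ⟨i, hi⟩ := (nextJump hσ hfin (jumpTime_lt_minExplosion hσ hfin n)).2.2
    refine Finset.sum_lt_sum (fun i _ => hmono n i) ⟨i, Finset.mem_univ i, ?_⟩
    change _ < birthProcess (σ i) (x₀ i) (jumpTime σ x₀ (n + 1)) at hi
    rw [hc, hc] at hi
    exact_mod_cast hi
  have h1 := hstep.id_le (∑ i, k i + 1)
  have h2 : ∑ i, c (∑ i, k i + 1) i ≤ ∑ i, k i := Finset.sum_le_sum fun i _ => hck _ i
  simp only [id] at h1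
  omega

theorem urnLimit_eq_iSup (hσ : ∀ i k, 0 < σ i (x₀ i + k)) (hfin : minExplosion σ x₀ < ∞)
    (i : Fin A) : urnLimit σ x₀ i = ⨆ n, urn σ x₀ n i :=
  (tendsto_atTop_iSup (urn_mono hσ hfin i)).limUnder_eq

theorem lt_urnLimit_iff (hσ : ∀ i k, 0 < σ i (x₀ i + k)) (hfin : minExplosion σ x₀ < ∞)
    (i : Fin A) (k : ℕ) :
    (k : ℕ∞) < urnLimit σ x₀ i ↔ ENNReal.ofReal (jumpSum (σ i) (x₀ i) k) < minExplosion σ x₀ := by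
  rw [urnLimit_eq_iSup hσ hfin, lt_iSup_iff]
  simp only [urn, lt_birthProcess_iff (hσ i)]
  constructor
  · rintro ⟨n, hn⟩
    exact (ENNReal.ofReal_le_ofReal hn).trans_lt (jumpTime_lt_minExplosion hσ hfin n)
  · intro h
    obtain ⟨n, hn⟩ := exists_lt_jumpTime hσ hfin h
    exact ⟨n, hn.le⟩

/-- An agent exploding at the first explosion time keeps winning as the jump times approach it; one
exploding strictly later is still in a finite state then. A tie at the first explosion excludes a
monopoly. -/
theorem strongMonopoly_iff (hσ : ∀ i k, 0 < σ i (x₀ i + k)) (hfin : minExplosion σ x₀ < ∞)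
    (i : Fin A) :
    StrongMonopoly σ x₀ i ↔ ∀ j, j ≠ i → minExplosion σ x₀ < explosionTime (σ j) (x₀ j) := by
  constructor
  · rintro ⟨N, hN⟩ j hji
    by_contra! hle
    obtain ⟨k, hk⟩ := exists_lt_jumpSum (hσ j)
      ((jumpTime_lt_minExplosion hσ hfin N).trans_le (iInf_le _ j))
    obtain ⟨n, hn⟩ := exists_lt_jumpTime hσ hfin ((ofReal_jumpSum_lt (hσ j) k).trans_le hle)
    have h1 : urn σ x₀ N j ≤ k := (birthProcess_le_iff (hσ j) _ k).2 hk
    have h2 : (k : ℕ∞) < urn σ x₀ n j := (lt_birthProcess_iff (hσ j) _ k).2 hn.le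
    have h3 := urn_mono hσ hfin j (le_max_left n N)
    have h4 := hN (max n N) (le_max_right n N) j hji
    exact absurd (h2.trans_le (h3.trans (h4.le.trans h1))) (lt_irrefl _)
  · intro h
    have hconst : ∀ j, ∃ N, j ≠ i → ∀ n, N ≤ n → urn σ x₀ n j = urn σ x₀ N j := by
      intro j
      by_cases hji : j = i
      · exact ⟨0, fun hne => absurd hji hne⟩
      have hlt := h j hji
      rw [← ENNReal.ofReal_toReal hfin.ne] at hlt
      obtain ⟨k, hk⟩ := exists_lt_jumpSum (hσ j) hlt
      obtain ⟨N, hN⟩ := exists_eventually_const_of_monotone_of_le (urn_mono hσ hfin j)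
        (k := k) fun n => by
        refine (birthProcess_le_iff (hσ j) _ k).2 (lt_trans ?_ hk)
        by_contra! hle
        have := ENNReal.ofReal_le_ofReal hle
        rw [ENNReal.ofReal_toReal hfin.ne] at this
        exact absurd (jumpTime_lt_minExplosion hσ hfin n) (not_lt.2 this)
      exact ⟨N, fun _ => hN⟩
    choose N hN using hconst
    refine ⟨Finset.univ.sup N, fun n hn j hji => ?_⟩
    have hj : N j ≤ Finset.univ.sup N := Finset.le_sup (Finset.mem_univ j)
    rw [hN j hji n (hj.trans hn), hN j hji _ hj]

theorem mem_firstAgents {a : ℕ} {i : Fin A} : i ∈ firstAgents A a ↔ i.val < a := by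
  simp [firstAgents]

theorem minExplosion_le_minOtherExplosion (a : ℕ) :
    minExplosion σ x₀ ≤ minOtherExplosion a σ x₀ :=
  le_iInf fun i => le_iInf fun _ => iInf_le _ i

theorem minOtherExplosion_le {a : ℕ} {i : Fin A} (hi : a ≤ i.val) :
    minOtherExplosion a σ x₀ ≤ explosionTime (σ i) (x₀ i) :=
  iInf₂_le (f := fun (i : Fin A) (_ : a ≤ i.val) => explosionTime (σ i) (x₀ i)) i hi

theorem minExplosion_eq_minOtherExplosion {a : ℕ}
    (h : ∀ i ∈ firstAgents A a, minOtherExplosion a σ x₀ < explosionTime (σ i) (x₀ i)) :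
    minExplosion σ x₀ = minOtherExplosion a σ x₀ := by
  refine le_antisymm (minExplosion_le_minOtherExplosion a) (le_iInf fun i => ?_)
  by_cases hi : i.val < a
  · exact (h i (mem_firstAgents.2 hi)).le
  · exact minOtherExplosion_le (not_lt.1 hi)

/-- If some `i` among the first `a` explodes no later than the others' minimum, then without ties
the first to explode is also among the first `a`, and it is strictly first, hence the monopolist. -/
theorem forall_not_strongMonopoly_iff (hσ : ∀ i k, 0 < σ i (x₀ i + k)) {a : ℕ}
    (hfin : minOtherExplosion a σ x₀ < ∞)
    (hne : ∀ i ∈ firstAgents A a, ∀ j, j ≠ i →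
      explosionTime (σ i) (x₀ i) ≠ explosionTime (σ j) (x₀ j)) :
    (∀ i ∈ firstAgents A a, ¬ StrongMonopoly σ x₀ i) ↔
      ∀ i ∈ firstAgents A a, minOtherExplosion a σ x₀ < explosionTime (σ i) (x₀ i) := by
  have hfin' := (minExplosion_le_minOtherExplosion (σ := σ) (x₀ := x₀) a).trans_lt hfin
  obtain ⟨m, hm⟩ := exists_explosionTime_eq_minExplosion hfin'
  constructor
  · intro h i hi
    by_contra! hle
    have hma : m ∈ firstAgents A a := by
      by_contra hma
      rw [mem_firstAgents, not_lt] at hma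
      refine hne i hi m (fun hmi => ?_) (le_antisymm (hle.trans (minOtherExplosion_le hma))
        (hm.le.trans (iInf_le _ i)))
      subst hmi
      exact absurd (mem_firstAgents.1 hi) (not_lt.2 hma)
    refine h m hma ((strongMonopoly_iff hσ hfin' m).2 fun j hj => ?_)
    exact lt_of_le_of_ne (iInf_le _ j) (hm ▸ hne m hma j hj)
  · intro h i hi hmon
    have hmi : m ≠ i := by
      rintro rfl
      have := h m hi
      rw [hm, minExplosion_eq_minOtherExplosion h] at this
      exact lt_irrefl _ this
    exact absurd ((strongMonopoly_iff hσ hfin' i).1 hmon m hmi) (by rw [hm]; exact lt_irrefl _)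

end Paths

/-! ### Tail sums of regularly varying sequences -/

section TailSums

variable {f : ℕ → ℝ}

theorem ExplosionCriterion.summable_shift (hs : ExplosionCriterion f) (x : ℕ) :
    Summable fun k => 1 / f (x + 1 + k) := by
  have := (summable_nat_add_iff x (f := fun k => 1 / f (k + 1))).2 hs
  refine this.congr fun k => ?_
  rw [show k + x + 1 = x + 1 + k by ring]

theorem tailSum_pos (hf : ∀ k, 1 ≤ k → 0 < f k) (hs : ExplosionCriterion f) (x : ℕ) :
    0 < tailSum f x :=
  (hs.summable_shift x).tsum_pos (fun k => (one_div_pos.2 (hf _ (by omega))).le) 0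
    (one_div_pos.2 (hf _ (by omega)))

theorem tailSum_floor_le_of_forall_le (hf : ∀ k, 1 ≤ k → 0 < f k) (hs : ExplosionCriterion f)
    {c K : ℝ} (hc : 0 < c) (hc1 : c ≤ 1) (hK : 0 ≤ K) {x : ℕ}
    (h : ∀ m : ℕ, x < m → 1 / f ⌊c * m⌋₊ ≤ K * (1 / f m)) :
    tailSum f ⌊c * x⌋₊ ≤ K * tailSum f x := by
  set y := ⌊c * x⌋₊ with hy
  -- A right inverse of `m ↦ ⌊c * m⌋₊` on the integers above `y`; `c ≤ 1` ensures that rounding up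
  -- does not overshoot. It is injective with values above `x`, so the tail beyond `y` is compared
  -- term by term with part of the tail beyond `x`.
  set m : ℕ → ℕ := fun k => ⌈((y + 1 + k : ℕ) : ℝ) / c⌉₊ with hm
  have hfloor : ∀ k, ⌊c * (m k : ℝ)⌋₊ = y + 1 + k := by
    intro k
    rw [Nat.floor_eq_iff (by positivity)]
    have h1 : ((y + 1 + k : ℕ) : ℝ) / c ≤ m k := Nat.le_ceil _
    have h2 : (m k : ℝ) < ((y + 1 + k : ℕ) : ℝ) / c + 1 := Nat.ceil_lt_add_one (by positivity)
    rw [div_le_iff₀ hc] at h1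
    rw [← sub_lt_iff_lt_add, lt_div_iff₀ hc] at h2
    constructor <;> nlinarith
  have hlt : ∀ k, x < m k := by
    intro k
    by_contra! hle
    have h1 : ⌊c * (m k : ℝ)⌋₊ ≤ y :=
      Nat.floor_le_floor (mul_le_mul_of_nonneg_left (by exact_mod_cast hle) hc.le)
    rw [hfloor] at h1
    omega
  have hinj : Function.Injective fun k => m k - (x + 1) := by
    intro k k' hkk
    have h1 := hlt k
    have h2 := hlt k'
    have h3 : m k = m k' := by simp only at hkk; omega
    have h4 := hfloor k
    rw [h3, hfloor k'] at h4
    omega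
  have hsum := (hs.summable_shift x).mul_left K
  have hcomp := hsum.comp_injective hinj
  have hpt : ∀ k, 1 / f (y + 1 + k) ≤ K * (1 / f (x + 1 + (m k - (x + 1)))) := by
    intro k
    rw [show x + 1 + (m k - (x + 1)) = m k by have := hlt k; omega]
    have := h (m k) (hlt k)
    rwa [hfloor] at this
  calc tailSum f y ≤ ∑' k, K * (1 / f (x + 1 + (m k - (x + 1)))) :=
        (hs.summable_shift y).tsum_le_tsum hpt hcomp
    _ ≤ ∑' k, K * (1 / f (x + 1 + k)) :=
        tsum_comp_le_tsum_of_inj hsum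
          (fun k => mul_nonneg hK (one_div_pos.2 (hf _ (by omega))).le) hinj
    _ = K * tailSum f x := tsum_mul_left

/-- The exponent is minus the index of `f`, not the sharp one for tail sums. It suffices that the
bound is finite for each fixed `c` and tends to `1` as `c` tends to `1`. -/
theorem RegularlyVarying.tailSum_floor_le (hreg : RegularlyVarying f)
    (hf : ∀ k, 1 ≤ k → 0 < f k) (hs : ExplosionCriterion f) :
    ∃ ρ : ℝ, ∀ c : ℝ, 0 < c → c ≤ 1 → ∀ K, c ^ ρ < K →
      ∀ᶠ x : ℕ in atTop, tailSum f ⌊c * x⌋₊ ≤ K * tailSum f x := by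
  obtain ⟨ρ, hρ⟩ := hreg
  refine ⟨-ρ, fun c hc hc1 K hK => ?_⟩
  have hpow : c ^ ρ ≠ 0 := (Real.rpow_pos_of_pos hc ρ).ne'
  have h1 := (hρ c hc).inv₀ hpow
  rw [← Real.rpow_neg hc.le] at h1
  obtain ⟨M, hM⟩ := eventually_atTop.1 (h1.eventually_lt_const hK)
  filter_upwards [eventually_ge_atTop M] with x hx
  refine tailSum_floor_le_of_forall_le hf hs hc hc1
    ((Real.rpow_pos_of_pos hc _).le.trans hK.le) fun m hm => ?_
  have h2 := (hM m (by omega)).le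
  have hfm : 0 < f m := hf m (by omega)
  rw [inv_div, div_eq_mul_one_div] at h2
  rw [mul_one_div, le_div_iff₀ hfm]
  linarith

end TailSums

/-! ### Asymptotic comparison -/

section Asymptotics

theorem tendsto_div_one_of_le {N D : ℕ → ℝ} (hD : ∀ x, 0 < D x)
    (hlow : ∀ ε > 0, ∀ᶠ x in atTop, (1 - ε) * D x ≤ N x)
    (hup : ∀ ε > 0, ∀ᶠ x in atTop, N x ≤ (1 + ε) * D x) :
    Tendsto (fun x => N x / D x) atTop (𝓝 1) := by
  rw [Metric.tendsto_nhds]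
  intro ε hε
  filter_upwards [hlow (ε / 2) (half_pos hε), hup (ε / 2) (half_pos hε)] with x h1 h2
  rw [← le_div_iff₀ (hD x)] at h1
  rw [← div_le_iff₀ (hD x)] at h2
  rw [Real.dist_eq, abs_lt]
  constructor <;> linarith

variable {U V r : ℕ → ℝ} {c : ℝ}

theorem eventually_le_of_tendsto_div (hr : ∀ x, 0 < r x)
    (hU : Tendsto (fun x => U x / r x) atTop (𝓝 c)) {K : ℝ} (hK : c < K) :
    ∀ᶠ x in atTop, U x ≤ K * r x := by
  filter_upwards [hU.eventually_lt_const hK] with x hx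
  exact ((div_lt_iff₀ (hr x)).1 hx).le

theorem eventually_ge_of_tendsto_div (hr : ∀ x, 0 < r x)
    (hU : Tendsto (fun x => U x / r x) atTop (𝓝 c)) {K : ℝ} (hK : K < c) :
    ∀ᶠ x in atTop, K * r x ≤ U x := by
  filter_upwards [hU.eventually_const_lt hK] with x hx
  exact ((lt_div_iff₀ (hr x)).1 hx).le

theorem tendsto_floor_mul {η : ℝ} (hη : 0 < η) :
    Tendsto (fun x : ℕ => ⌊η * x⌋₊) atTop atTop :=
  tendsto_nat_floor_atTop.comp (tendsto_natCast_atTop_atTop.const_mul_atTop hη)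

theorem eventually_comp_floor_le (hr : ∀ x, 0 < r x) (hc : 0 < c)
    (hU : Tendsto (fun x => U x / r x) atTop (𝓝 c)) {ρ : ℝ}
    (hreg : ∀ η : ℝ, 0 < η → η ≤ 1 → ∀ K, η ^ ρ < K →
      ∀ᶠ x : ℕ in atTop, r ⌊η * x⌋₊ ≤ K * r x) {ε : ℝ} (hε : 0 < ε) :
    ∀ᶠ η : ℝ in 𝓝[>] 0, ∀ᶠ x : ℕ in atTop, U ⌊(1 - η) * x⌋₊ ≤ (1 + ε) * (c * r x) := by
  -- One factor `K` pays for replacing `U` by `c * r`, the other for moving `r` from `⌊(1 - η) *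
  -- x⌋₊` to `x`.
  obtain ⟨K, hK1, hK2⟩ : ∃ K : ℝ, 1 < K ∧ K * K ≤ 1 + ε := by
    refine ⟨Real.sqrt (1 + ε), ?_, (Real.mul_self_sqrt (by linarith)).le⟩
    rw [Real.lt_sqrt zero_le_one]
    linarith
  have hcont : Tendsto (fun η : ℝ => (1 - η) ^ ρ) (𝓝[>] 0) (𝓝 1) := by
    have : ContinuousAt (fun η : ℝ => (1 - η) ^ ρ) 0 :=
      ContinuousAt.rpow_const (by fun_prop) (Or.inl (by norm_num))
    have h := this.tendsto
    simp only [sub_zero, Real.one_rpow] at h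
    exact h.mono_left nhdsWithin_le_nhds
  have hlt1 : ∀ᶠ η : ℝ in 𝓝[>] 0, η < 1 :=
    mem_nhdsWithin_of_mem_nhds (gt_mem_nhds one_pos)
  filter_upwards [hcont.eventually_lt_const hK1, hlt1, self_mem_nhdsWithin] with η h1 h2 h3
  have h3' : 0 < η := h3
  have hfl := (tendsto_floor_mul (sub_pos.2 h2)).eventually
    (eventually_le_of_tendsto_div hr hU (K := K * c) (by nlinarith))
  filter_upwards [hfl, hreg (1 - η) (sub_pos.2 h2) (by linarith) K h1] with x h4 h5
  have hKc : 0 ≤ K * c := by positivity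
  calc U ⌊(1 - η) * x⌋₊ ≤ K * c * r ⌊(1 - η) * x⌋₊ := h4
    _ ≤ K * c * (K * r x) := mul_le_mul_of_nonneg_left h5 hKc
    _ = K * K * (c * r x) := by ring
    _ ≤ (1 + ε) * (c * r x) := mul_le_mul_of_nonneg_right hK2 (mul_pos hc (hr x)).le

/-- `U - V` is of smaller order than `r`, and changing the level from `x` to `η * x` costs only a
constant factor. -/
theorem eventually_sub_comp_floor_le (hr : ∀ x, 0 < r x) (hc : 0 < c)
    (hU : Tendsto (fun x => U x / r x) atTop (𝓝 c))
    (hV : Tendsto (fun x => V x / r x) atTop (𝓝 c)) {ρ : ℝ}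
    (hreg : ∀ η : ℝ, 0 < η → η ≤ 1 → ∀ K, η ^ ρ < K →
      ∀ᶠ x : ℕ in atTop, r ⌊η * x⌋₊ ≤ K * r x) {η : ℝ} (hη : 0 < η) (hη1 : η ≤ 1)
    {ε : ℝ} (hε : 0 < ε) :
    ∀ᶠ x : ℕ in atTop, U ⌊η * x⌋₊ - V ⌊η * x⌋₊ ≤ ε * (c * r x) := by
  have hUV : Tendsto (fun x => (U x - V x) / r x) atTop (𝓝 0) := by
    have := hU.sub hV
    simpa only [sub_self, ← sub_div] using this
  have hp := Real.rpow_pos_of_pos hη ρ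
  set K := η ^ ρ + 1 with hK
  have hKpos : 0 < K := by positivity
  filter_upwards [(tendsto_floor_mul hη).eventually
    (eventually_le_of_tendsto_div hr hUV (K := ε * c / K) (by positivity)),
    hreg η hη hη1 K (by linarith)] with x h1 h2
  calc U ⌊η * x⌋₊ - V ⌊η * x⌋₊ ≤ ε * c / K * r ⌊η * x⌋₊ := h1
    _ ≤ ε * c / K * (K * r x) := mul_le_mul_of_nonneg_left h2 (by positivity)
    _ = ε * (c * r x) := by field_simp

end Asymptotics

/-! ### Sandwich arguments for sums over several agents -/

section FinsetAsymptotics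

variable {ι : Type*} {I : Finset ι} {U V r : ι → ℕ → ℝ} {c : ι → ℝ} {N : ℕ → ℝ}

theorem eventually_le_of_sum_le (hr : ∀ i ∈ I, ∀ x, 0 < r i x) (hc : ∀ i ∈ I, 0 < c i)
    (hV : ∀ i ∈ I, Tendsto (fun x => V i x / r i x) atTop (𝓝 (c i)))
    (hlow : ∀ᶠ x in atTop, ∑ i ∈ I, V i x ≤ N x) {ε : ℝ} (hε : 0 < ε) :
    ∀ᶠ x in atTop, (1 - ε) * ∑ i ∈ I, c i * r i x ≤ N x := by
  have h1 : ∀ᶠ x in atTop, ∀ i ∈ I, (1 - ε) * c i * r i x ≤ V i x :=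
    (Finset.eventually_all I).2 fun i hi => eventually_ge_of_tendsto_div (hr i hi) (hV i hi)
      (by have := hc i hi; nlinarith)
  filter_upwards [h1, hlow] with x h2 h3
  refine le_trans ?_ h3
  rw [Finset.mul_sum]
  exact Finset.sum_le_sum fun i hi => by rw [← mul_assoc]; exact h2 i hi

theorem tendsto_div_sum_of_sum_le (hI : I.Nonempty) (hr : ∀ i ∈ I, ∀ x, 0 < r i x)
    (hc : ∀ i ∈ I, 0 < c i)
    (hU : ∀ i ∈ I, Tendsto (fun x => U i x / r i x) atTop (𝓝 (c i)))
    (hV : ∀ i ∈ I, Tendsto (fun x => V i x / r i x) atTop (𝓝 (c i)))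
    (hlow : ∀ᶠ x in atTop, ∑ i ∈ I, V i x ≤ N x) (hup : ∀ᶠ x in atTop, N x ≤ ∑ i ∈ I, U i x) :
    Tendsto (fun x => N x / ∑ i ∈ I, c i * r i x) atTop (𝓝 1) := by
  refine tendsto_div_one_of_le (fun x => Finset.sum_pos
    (fun i hi => mul_pos (hc i hi) (hr i hi x)) hI)
    (fun ε hε => eventually_le_of_sum_le hr hc hV hlow hε) fun ε hε => ?_
  have h1 : ∀ᶠ x in atTop, ∀ i ∈ I, U i x ≤ (1 + ε) * c i * r i x :=
    (Finset.eventually_all I).2 fun i hi => eventually_le_of_tendsto_div (hr i hi) (hU i hi)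
      (by have := hc i hi; nlinarith)
  filter_upwards [h1, hup] with x h2 h3
  refine h3.trans ?_
  rw [Finset.mul_sum]
  exact Finset.sum_le_sum fun i hi => by rw [← mul_assoc]; exact h2 i hi

theorem tendsto_div_sum_of_sum_floor_le (hI : I.Nonempty) (hr : ∀ i ∈ I, ∀ x, 0 < r i x)
    (hc : ∀ i ∈ I, 0 < c i)
    (hU : ∀ i ∈ I, Tendsto (fun x => U i x / r i x) atTop (𝓝 (c i)))
    (hV : ∀ i ∈ I, Tendsto (fun x => V i x / r i x) atTop (𝓝 (c i)))
    (hreg : ∀ i ∈ I, ∃ ρ : ℝ, ∀ η : ℝ, 0 < η → η ≤ 1 → ∀ K, η ^ ρ < K →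
      ∀ᶠ x : ℕ in atTop, r i ⌊η * x⌋₊ ≤ K * r i x)
    (hlow : ∀ᶠ x in atTop, ∑ i ∈ I, V i x ≤ N x)
    (hup : ∀ η : ℝ, 0 < η → η < 1 → ∀ᶠ x : ℕ in atTop, N x ≤ ∑ i ∈ I, U i ⌊(1 - η) * x⌋₊ +
      ∑ i ∈ I, (U i ⌊η / I.card * x⌋₊ - V i ⌊η / I.card * x⌋₊)) :
    Tendsto (fun x => N x / ∑ i ∈ I, c i * r i x) atTop (𝓝 1) := by
  refine tendsto_div_one_of_le (fun x => Finset.sum_pos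
    (fun i hi => mul_pos (hc i hi) (hr i hi x)) hI)
    (fun ε hε => eventually_le_of_sum_le hr hc hV hlow hε) fun ε hε => ?_
  choose! ρ hρ using hreg
  have h1 : ∀ᶠ η : ℝ in 𝓝[>] 0, ∀ i ∈ I, ∀ᶠ x : ℕ in atTop,
      U i ⌊(1 - η) * x⌋₊ ≤ (1 + ε / 2) * (c i * r i x) :=
    (Finset.eventually_all I).2 fun i hi =>
      eventually_comp_floor_le (hr i hi) (hc i hi) (hU i hi) (hρ i hi) (half_pos hε)
  have hlt1 : ∀ᶠ η : ℝ in 𝓝[>] 0, η < 1 := mem_nhdsWithin_of_mem_nhds (gt_mem_nhds one_pos)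
  -- Here `η` is fixed to make the main term accurate up to `ε / 2`; the error term at level `η /
  -- I.card * x` is then negligible for this fixed `η` as `x` grows.
  obtain ⟨η, hη, hη1, hη0⟩ := (h1.and (hlt1.and self_mem_nhdsWithin)).exists
  have hη0' : 0 < η := hη0
  have hcard : (1 : ℝ) ≤ I.card := by exact_mod_cast hI.card_pos
  have h2 : ∀ᶠ x : ℕ in atTop, ∀ i ∈ I,
      U i ⌊η / I.card * x⌋₊ - V i ⌊η / I.card * x⌋₊ ≤ ε / 2 * (c i * r i x) :=
    (Finset.eventually_all I).2 fun i hi =>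
      eventually_sub_comp_floor_le (hr i hi) (hc i hi) (hU i hi) (hV i hi) (hρ i hi)
        (by positivity) ((div_le_self hη0'.le hcard).trans hη1.le) (half_pos hε)
  filter_upwards [h2, (Finset.eventually_all I).2 hη, hup η hη0' hη1] with x h3 h4 h5
  refine h5.trans ?_
  rw [← Finset.sum_add_distrib, Finset.mul_sum]
  exact Finset.sum_le_sum fun i hi => by linarith [h3 i hi, h4 i hi]

end FinsetAsymptotics

/-! ### Independent rows -/

section Survival

variable {Ω : Type*} [MeasurableSpace Ω] {P : Measure Ω}
  {ξ : ℕ → Ω → ℝ} {l : ℕ → ℝ}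

/-- The probability that the total time exceeds `t`. -/
noncomputable def survival (P : Measure Ω) (ξ : ℕ → Ω → ℝ) (t : ℝ) : ℝ :=
  P.real {ω | ENNReal.ofReal t < totalTime ξ ω}

/-- Pairs of a time and a sequence of sojourn times with total time exceeding this time. -/
def surviveSet : Set (ℝ × (ℕ → ℝ)) :=
  {p | ENNReal.ofReal p.1 < ∑' k, ENNReal.ofReal (p.2 k)}

/-- Pairs of a time and a sequence of sojourn times with `n`-th partial sum below this time. -/
def exceedSet (n : ℕ) : Set (ℝ × (ℕ → ℝ)) :=
  {p | ∑ k ∈ Finset.range n, p.2 k < p.1}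

theorem measurableSet_surviveSet : MeasurableSet surviveSet :=
  measurableSet_lt measurable_fst.ennreal_ofReal (Measurable.tsum fun k =>
    ((measurable_pi_apply k).comp measurable_snd).ennreal_ofReal)

theorem measurableSet_exceedSet (n : ℕ) : MeasurableSet (exceedSet n) :=
  measurableSet_lt (Finset.measurable_fun_sum _ fun k _ =>
    (measurable_pi_apply k).comp measurable_snd) measurable_fst

theorem ExpRow.measurable_seq (h : ExpRow P ξ l) : Measurable fun ω k => ξ k ω :=
  measurable_pi_lambda _ h.meas

theorem survival_nonneg (ξ : ℕ → Ω → ℝ) (t : ℝ) : 0 ≤ survival P ξ t := measureReal_nonneg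

theorem gapProb_nonneg (ξ : ℕ → Ω → ℝ) (n : ℕ) (t : ℝ) : 0 ≤ gapProb P ξ n t := measureReal_nonneg

variable [IsProbabilityMeasure P]

theorem ExpRow.measurable_survival (h : ExpRow P ξ l) : Measurable (survival P ξ) := by
  have hp := Measure.isProbabilityMeasure_map (μ := P) h.measurable_seq.aemeasurable
  have := (measurable_measure_prodMk_left (ν := P.map fun ω k => ξ k ω)
    measurableSet_surviveSet).ennreal_toReal
  convert this using 1
  ext t
  rw [Measure.map_apply h.measurable_seq (measurable_prodMk_left measurableSet_surviveSet)]
  rfl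

theorem ExpRow.measurable_gapProb (h : ExpRow P ξ l) (n : ℕ) : Measurable (gapProb P ξ n) := by
  have hp := Measure.isProbabilityMeasure_map (μ := P) h.measurable_seq.aemeasurable
  have hms := (measurableSet_exceedSet n).inter measurableSet_surviveSet
  have := (measurable_measure_prodMk_left (ν := P.map fun ω k => ξ k ω) hms).ennreal_toReal
  convert this using 1
  ext t
  rw [Measure.map_apply h.measurable_seq (measurable_prodMk_left hms)]
  rfl

theorem survival_le_one (ξ : ℕ → Ω → ℝ) (t : ℝ) : survival P ξ t ≤ 1 := measureReal_le_one

theorem gapProb_le_survival (ξ : ℕ → Ω → ℝ) (n : ℕ) (t : ℝ) : gapProb P ξ n t ≤ survival P ξ t :=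
  measureReal_mono fun _ hω => hω.2

theorem ExpRow.measureReal_le_partialSum (h : ExpRow P ξ l) (n : ℕ) (t : ℝ) :
    P.real {ω | ¬ partialSum ξ n ω < t ∧ ENNReal.ofReal t < totalTime ξ ω} =
      survival P ξ t - gapProb P ξ n t := by
  have hms : MeasurableSet {ω | partialSum ξ n ω < t} :=
    measurableSet_lt (h.measurable_partialSum n) measurable_const
  have h1 := measureReal_inter_add_sdiff (μ := P) (s := {ω | ENNReal.ofReal t < totalTime ξ ω}) hms
  have h2 : {ω | ENNReal.ofReal t < totalTime ξ ω} ∩ {ω | partialSum ξ n ω < t} =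
      {ω | partialSum ξ n ω < t ∧ ENNReal.ofReal t < totalTime ξ ω} := by
    ext ω; exact and_comm
  have h3 : {ω | ENNReal.ofReal t < totalTime ξ ω} \ {ω | partialSum ξ n ω < t} =
      {ω | ¬ partialSum ξ n ω < t ∧ ENNReal.ofReal t < totalTime ξ ω} := by
    ext ω; exact and_comm
  rw [h2, h3] at h1
  unfold survival gapProb
  linarith

variable {S : Ω → ℝ}

theorem ExpRow.integrable_totalDensity_comp_mul (h : ExpRow P ξ l)
    {g q : Ω → ℝ} (hg : AEStronglyMeasurable g P) (hgd : ∀ᵐ ω ∂P, g ω = totalDensity P ξ l (S ω))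
    (hq : AEStronglyMeasurable q P) (hq0 : ∀ ω, 0 ≤ q ω) (hq1 : ∀ ω, q ω ≤ 1) :
    Integrable (fun ω => q ω * g ω) P := by
  refine Integrable.of_bound (hq.mul hg) (l 0) ?_
  filter_upwards [hgd] with ω hω
  have h1 : 0 ≤ totalDensity P ξ l (S ω) := integral_expDensity_nonneg (h.rate_pos 0) _ _
  rw [hω, Real.norm_eq_abs, abs_of_nonneg (mul_nonneg (hq0 ω) h1)]
  exact (mul_le_of_le_one_left h1 (hq1 ω)).trans (h.totalDensity_le _)

/-- The weights `q` carry the factors of the other agents; being in `[0, 1]`, they keep the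
dominating constant `l 0`. -/
theorem ExpRow.tendsto_integral_gapProb_div (h : ExpRow P ξ l) (hs : Summable fun k => 1 / l k)
    (hS : Measurable S) (hS0 : ∀ᵐ ω ∂P, 0 < S ω) {n : ℕ → ℕ} (hn : Tendsto n atTop atTop)
    {q : ℕ → Ω → ℝ} {q' : Ω → ℝ} (hq : ∀ x, Measurable (q x)) (hq0 : ∀ x ω, 0 ≤ q x ω)
    (hq1 : ∀ x ω, q x ω ≤ 1) (hlim : ∀ᵐ ω ∂P, Tendsto (fun x => q x ω) atTop (𝓝 (q' ω))) :
    Tendsto (fun x => (∫ ω, q x ω * gapProb P ξ (n x) (S ω) ∂P) / ∑' k, 1 / l (k + n x)) atTop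
      (𝓝 (∫ ω, q' ω * totalDensity P ξ l (S ω) ∂P)) := by
  simp_rw [← integral_div]
  refine tendsto_integral_filter_of_dominated_convergence (fun _ => l 0)
    (Eventually.of_forall fun x => ?_) ?_ (integrable_const _) ?_
  · exact (((hq x).mul ((h.measurable_gapProb (n x)).comp hS)).div_const _).aestronglyMeasurable
  · filter_upwards [hn.eventually (eventually_ge_atTop 1)] with x hx
    filter_upwards [hS0] with ω hω
    have hr := h.tsum_pos hs (n x)
    have hg := gapProb_nonneg (P := P) ξ (n x) (S ω)
    rw [Real.norm_eq_abs, abs_of_nonneg (div_nonneg (mul_nonneg (hq0 x ω) hg) hr.le), div_le_iff₀ hr]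
    exact (mul_le_of_le_one_left hg (hq1 x ω)).trans (h.gapProb_le hs (by omega) hω)
  · filter_upwards [hS0, hlim] with ω hω hl
    simp_rw [mul_div_assoc]
    exact hl.mul ((h.tendsto_gapProb_div hs hω).comp hn)

end Survival

/-! ### Several independent rows, conditioned on the minimum of the last ones -/

section Family

variable {Ω : Type*} {A : ℕ} {ξ : Fin A → ℕ → Ω → ℝ}

/-- The smallest total time of the rows from the `a`-th row on. -/
noncomputable def minTotal (a : ℕ) (ξ : Fin A → ℕ → Ω → ℝ) (ω : Ω) : ℝ≥0∞ :=
  ⨅ i : Fin A, ⨅ _ : a ≤ i.val, totalTime (ξ i) ω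

theorem minTotal_le {a : ℕ} {i : Fin A} (hi : a ≤ i.val) (ω : Ω) :
    minTotal a ξ ω ≤ totalTime (ξ i) ω :=
  iInf₂_le (f := fun (i : Fin A) (_ : a ≤ i.val) => totalTime (ξ i) ω) i hi

variable [MeasurableSpace Ω] {P : Measure Ω} {l : Fin A → ℕ → ℝ}

/-- Independent rows of independent exponential variables. -/
structure ExpFamily (P : Measure Ω) (ξ : Fin A → ℕ → Ω → ℝ) (l : Fin A → ℕ → ℝ) : Prop where
  row : ∀ i, ExpRow P (ξ i) (l i)
  indep : iIndepFun (fun i ω k => ξ i k ω) P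

theorem ExpFamily.measurable_minTotal (h : ExpFamily P ξ l) (a : ℕ) : Measurable (minTotal a ξ) :=
  Measurable.iInf fun i => Measurable.iInf fun _ => (h.row i).measurable_totalTime

theorem ExpFamily.ae_minTotal_lt_top (h : ExpFamily P ξ l) {a : ℕ} {j : Fin A} (hj : a ≤ j.val)
    (hs : Summable fun k => 1 / l j k) : ∀ᵐ ω ∂P, minTotal a ξ ω < ∞ := by
  filter_upwards [(h.row j).ae_totalTime_lt_top hs] with ω hω using (minTotal_le hj ω).trans_lt hω

theorem ExpFamily.indepFun_minTotal (h : ExpFamily P ξ l) (a : ℕ) :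
    IndepFun (fun ω => (minTotal a ξ ω).toReal)
      (fun ω (i : firstAgents A a) k => ξ i k ω) P := by
  have hind := h.indep.indepFun_finset (firstAgents A a)ᶜ (firstAgents A a) disjoint_compl_left
    fun i => (h.row i).measurable_seq
  have hmem : ∀ i : Fin A, a ≤ i.val → i ∈ (firstAgents A a)ᶜ := fun i hi => by
    simpa [firstAgents] using hi
  refine hind.comp (φ := fun f : ↥((firstAgents A a)ᶜ) → ℕ → ℝ =>
    (⨅ i : Fin A, ⨅ hi : a ≤ i.val, ∑' k, ENNReal.ofReal (f ⟨i, hmem i hi⟩ k)).toReal)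
    (ψ := id) ?_ measurable_id
  refine (Measurable.iInf fun i => Measurable.iInf fun hi => Measurable.tsum fun k => ?_).ennreal_toReal
  exact ((measurable_pi_apply k).comp (measurable_pi_apply _)).ennreal_ofReal

variable [IsProbabilityMeasure P]

/-- The minimum depends only on the rows from `a` on, so it can be frozen; the remaining rows are
independent and the probability factors. -/
theorem ExpFamily.measureReal_forall (h : ExpFamily P ξ l) (a : ℕ)
    {B : Fin A → Set (ℝ × (ℕ → ℝ))} (hB : ∀ i, MeasurableSet (B i)) :
    P.real {ω | ∀ i ∈ firstAgents A a, ((minTotal a ξ ω).toReal, fun k => ξ i k ω) ∈ B i} =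
      ∫ ω, ∏ i ∈ firstAgents A a,
        P.real {ω' | ((minTotal a ξ ω).toReal, fun k => ξ i k ω') ∈ B i} ∂P := by
  have hX : Measurable fun ω (i : firstAgents A a) k => ξ i k ω :=
    measurable_pi_lambda _ fun i => (h.row i).measurable_seq
  have hC : MeasurableSet {p : ℝ × (firstAgents A a → ℕ → ℝ) |
      ∀ i : firstAgents A a, (p.1, p.2 i) ∈ B i} := by
    have heq : {p : ℝ × (firstAgents A a → ℕ → ℝ) |
      ∀ i : firstAgents A a, (p.1, p.2 i) ∈ B i} =
        ⋂ i : firstAgents A a, (fun p : ℝ × (firstAgents A a → ℕ → ℝ) => (p.1, p.2 i)) ⁻¹' B i := by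
      ext p; simp
    rw [heq]
    exact MeasurableSet.iInter fun i => measurable_fst.prodMk
      ((measurable_pi_apply i).comp measurable_snd) (hB i)
  have hsec := integral_section hX (h.measurable_minTotal a).ennreal_toReal
    (h.indepFun_minTotal a) hC
  have hset : {ω | ∀ i ∈ firstAgents A a, ((minTotal a ξ ω).toReal, fun k => ξ i k ω) ∈ B i} =
      {ω | ((minTotal a ξ ω).toReal, fun (i : firstAgents A a) k => ξ i k ω) ∈
        {p : ℝ × (firstAgents A a → ℕ → ℝ) |
      ∀ i : firstAgents A a, (p.1, p.2 i) ∈ B i}} := by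
    ext ω; simp
  rw [hset, hsec]
  refine integral_congr_ae (ae_of_all _ fun ω => ?_)
  have hprod := h.indep.meas_biInter (S := firstAgents A a)
    (s := fun i => {ω' | ((minTotal a ξ ω).toReal, fun k => ξ i k ω') ∈ B i})
    fun i _ => ⟨_, measurable_prodMk_left (hB i), rfl⟩
  simp only [measureReal_def]
  rw [← ENNReal.toReal_prod, ← hprod]
  congr 2
  ext ω'
  simp

theorem ExpFamily.measureReal_and_forall_erase (h : ExpFamily P ξ l) (a : ℕ)
    {B : Fin A → Set (ℝ × (ℕ → ℝ))} {C : Set (ℝ × (ℕ → ℝ))} (hB : ∀ i, MeasurableSet (B i))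
    (hC : MeasurableSet C) {i : Fin A} (hi : i ∈ firstAgents A a) :
    P.real {ω | ((minTotal a ξ ω).toReal, fun k => ξ i k ω) ∈ C ∧
        ∀ j ∈ (firstAgents A a).erase i, ((minTotal a ξ ω).toReal, fun k => ξ j k ω) ∈ B j} =
      ∫ ω, (∏ j ∈ (firstAgents A a).erase i,
          P.real {ω' | ((minTotal a ξ ω).toReal, fun k => ξ j k ω') ∈ B j}) *
        P.real {ω' | ((minTotal a ξ ω).toReal, fun k => ξ i k ω') ∈ C} ∂P := by
  -- Row `i` gets its own condition `C` by updating the family `B` at `i`.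
  have hU : ∀ j, MeasurableSet (Function.update B i C j) := fun j => by
    by_cases hj : j = i
    · subst hj; simpa using hC
    · simpa [hj] using hB j
  have hne : ∀ j ∈ (firstAgents A a).erase i, Function.update B i C j = B j :=
    fun j hj => Function.update_of_ne (Finset.ne_of_mem_erase hj) _ _
  have key := h.measureReal_forall a hU
  have hset : {ω | ∀ j ∈ firstAgents A a,
        ((minTotal a ξ ω).toReal, fun k => ξ j k ω) ∈ Function.update B i C j} =
      {ω | ((minTotal a ξ ω).toReal, fun k => ξ i k ω) ∈ C ∧
        ∀ j ∈ (firstAgents A a).erase i, ((minTotal a ξ ω).toReal, fun k => ξ j k ω) ∈ B j} := by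
    ext ω
    constructor
    · intro hω
      refine ⟨by simpa using hω i hi, fun j hj => ?_⟩
      rw [← hne j hj]
      exact hω j (Finset.mem_of_mem_erase hj)
    · rintro ⟨h1, h2⟩ j hj
      by_cases hji : j = i
      · subst hji; simpa using h1
      · have := Finset.mem_erase.2 ⟨hji, hj⟩
        rw [hne j this]
        exact h2 j this
  rw [← hset, key]
  refine integral_congr_ae (ae_of_all _ fun ω => ?_)
  simp only
  rw [← Finset.prod_erase_mul _ _ hi, Function.update_self]
  congr 1
  exact Finset.prod_congr rfl fun j hj => by rw [hne j hj]

/-- Only row `i` has to be summable: its total time has no atom, so comparison after `toReal` is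
harmless even where the other total time is infinite. -/
theorem ExpFamily.ae_totalTime_ne (h : ExpFamily P ξ l) {i : Fin A}
    (hs : Summable fun k => 1 / l i k) {j : Fin A} (hj : j ≠ i) :
    ∀ᵐ ω ∂P, totalTime (ξ i) ω ≠ totalTime (ξ j) ω := by
  have hφ : Measurable fun f : ℕ → ℝ => (∑' k, ENNReal.ofReal (f k)).toReal :=
    (Measurable.tsum fun k => (measurable_pi_apply k).ennreal_ofReal).ennreal_toReal
  have h0 := measure_eq_eq_zero_of_indepFun (h.row i).measurable_totalTime.ennreal_toReal
    (h.row j).measurable_totalTime.ennreal_toReal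
    ((h.indep.indepFun hj.symm).comp hφ hφ) ((h.row i).measure_toReal_totalTime_eq hs)
  have h1 : ∀ᵐ ω ∂P, (totalTime (ξ i) ω).toReal ≠ (totalTime (ξ j) ω).toReal := by
    rw [ae_iff]; simpa using h0
  filter_upwards [h1] with ω hω heq using hω (congrArg ENNReal.toReal heq)

theorem ExpFamily.ae_minTotal_pos (h : ExpFamily P ξ l) {a : ℕ} (ha : a < A) :
    ∀ᵐ ω ∂P, 0 < minTotal a ξ ω := by
  have : Nonempty (Fin A) := ⟨⟨a, ha⟩⟩
  filter_upwards [ae_all_iff.2 fun i => (h.row i).ae_pos] with ω hω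
  obtain ⟨i, hi⟩ := exists_eq_ciInf_of_finite
    (f := fun i : Fin A => ⨅ _ : a ≤ i.val, totalTime (ξ i) ω)
  rw [minTotal, ← hi]
  by_cases hai : a ≤ i.val
  · simpa [hai] using totalTime_pos (hω i)
  · simp [hai]

end Family

/-! ### Probabilities of the loss and exceedance events -/

section LossEvents

variable {Ω : Type*} [MeasurableSpace Ω] {P : Measure Ω} {A : ℕ}
  {ξ : Fin A → ℕ → Ω → ℝ} {l : Fin A → ℕ → ℝ}

/-- The first `a` rows have total time larger than the minimum of the others. -/
def lossEvent (a : ℕ) (ξ : Fin A → ℕ → Ω → ℝ) : Set Ω :=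
  {ω | ∀ i ∈ firstAgents A a, ENNReal.ofReal (minTotal a ξ ω).toReal < totalTime (ξ i) ω}

/-- The first `a` agents lose, and agent `i` makes at least `n` steps. -/
def exceedEvent (a : ℕ) (ξ : Fin A → ℕ → Ω → ℝ) (n : ℕ) (i : Fin A) : Set Ω :=
  {ω | partialSum (ξ i) n ω < (minTotal a ξ ω).toReal} ∩ lossEvent a ξ

/-- The first `a` agents lose, and among them only agent `i` makes at least `n i` steps. -/
def onlyExceedEvent (a : ℕ) (ξ : Fin A → ℕ → Ω → ℝ) (n : Fin A → ℕ) (i : Fin A) : Set Ω :=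
  exceedEvent a ξ (n i) i ∩
    {ω | ∀ j ∈ (firstAgents A a).erase i, ¬ partialSum (ξ j) (n j) ω < (minTotal a ξ ω).toReal}

theorem ExpFamily.measurableSet_lossEvent (h : ExpFamily P ξ l) (a : ℕ) :
    MeasurableSet (lossEvent a ξ) := by
  have heq : lossEvent a ξ = ⋂ i ∈ firstAgents A a,
      {ω | ENNReal.ofReal (minTotal a ξ ω).toReal < totalTime (ξ i) ω} := by
    ext ω; simp [lossEvent]
  rw [heq]
  exact Finset.measurableSet_biInter _ fun i _ => measurableSet_lt
    (h.measurable_minTotal a).ennreal_toReal.ennreal_ofReal (h.row i).measurable_totalTime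

theorem ExpFamily.measurableSet_lt_minTotal (h : ExpFamily P ξ l) (a n : ℕ) (i : Fin A) :
    MeasurableSet {ω | partialSum (ξ i) n ω < (minTotal a ξ ω).toReal} :=
  measurableSet_lt ((h.row i).measurable_partialSum n) (h.measurable_minTotal a).ennreal_toReal

theorem ExpFamily.measurableSet_exceedEvent (h : ExpFamily P ξ l) (a n : ℕ) (i : Fin A) :
    MeasurableSet (exceedEvent a ξ n i) :=
  (h.measurableSet_lt_minTotal a n i).inter (h.measurableSet_lossEvent a)

theorem ExpFamily.measurableSet_onlyExceedEvent (h : ExpFamily P ξ l) (a : ℕ) (n : Fin A → ℕ)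
    (i : Fin A) : MeasurableSet (onlyExceedEvent a ξ n i) := by
  refine (h.measurableSet_exceedEvent a (n i) i).inter ?_
  have heq : {ω | ∀ j ∈ (firstAgents A a).erase i,
      ¬ partialSum (ξ j) (n j) ω < (minTotal a ξ ω).toReal} =
      ⋂ j ∈ (firstAgents A a).erase i,
        {ω | partialSum (ξ j) (n j) ω < (minTotal a ξ ω).toReal}ᶜ := by
    ext ω; simp
  rw [heq]
  exact Finset.measurableSet_biInter _ fun j _ => (h.measurableSet_lt_minTotal a (n j) j).compl

theorem forall_firstAgents_iff {a : ℕ} {i : Fin A} (hi : i ∈ firstAgents A a) {p : Fin A → Prop} :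
    (∀ j ∈ firstAgents A a, p j) ↔ p i ∧ ∀ j ∈ (firstAgents A a).erase i, p j := by
  conv_lhs => rw [← Finset.insert_erase hi]
  exact Finset.forall_mem_insert _ _ _

variable [IsProbabilityMeasure P]

theorem ExpFamily.measureReal_lossEvent (h : ExpFamily P ξ l) (a : ℕ) :
    P.real (lossEvent a ξ) =
      ∫ ω, ∏ i ∈ firstAgents A a, survival P (ξ i) (minTotal a ξ ω).toReal ∂P :=
  h.measureReal_forall a (B := fun _ => surviveSet) fun _ => measurableSet_surviveSet

theorem ExpFamily.measureReal_iInter_exceedEvent (h : ExpFamily P ξ l) (a : ℕ) (n : Fin A → ℕ) :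
    P.real {ω | (∀ i ∈ firstAgents A a, partialSum (ξ i) (n i) ω < (minTotal a ξ ω).toReal) ∧
        ω ∈ lossEvent a ξ} =
      ∫ ω, ∏ i ∈ firstAgents A a, gapProb P (ξ i) (n i) (minTotal a ξ ω).toReal ∂P := by
  rw [show (∫ ω, ∏ i ∈ firstAgents A a, gapProb P (ξ i) (n i) (minTotal a ξ ω).toReal ∂P) = _ from
    (h.measureReal_forall a (B := fun i => exceedSet (n i) ∩ surviveSet)
      fun i => (measurableSet_exceedSet (n i)).inter measurableSet_surviveSet).symm]
  congr 1
  ext ω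
  exact forall₂_and.symm

theorem ExpFamily.measureReal_exceedEvent (h : ExpFamily P ξ l) (a n : ℕ) {i : Fin A}
    (hi : i ∈ firstAgents A a) :
    P.real (exceedEvent a ξ n i) =
      ∫ ω, (∏ j ∈ (firstAgents A a).erase i, survival P (ξ j) (minTotal a ξ ω).toReal) *
        gapProb P (ξ i) n (minTotal a ξ ω).toReal ∂P := by
  rw [show (∫ ω, (∏ j ∈ (firstAgents A a).erase i, survival P (ξ j) (minTotal a ξ ω).toReal) *
      gapProb P (ξ i) n (minTotal a ξ ω).toReal ∂P) = _ from
    (h.measureReal_and_forall_erase a (B := fun _ => surviveSet) (C := exceedSet n ∩ surviveSet)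
      (fun _ => measurableSet_surviveSet)
      ((measurableSet_exceedSet n).inter measurableSet_surviveSet) hi).symm]
  congr 1
  ext ω
  change _ ∧ (∀ j ∈ firstAgents A a, _) ↔ (_ ∧ _) ∧ _
  rw [forall_firstAgents_iff hi, and_assoc]
  rfl

theorem ExpFamily.measureReal_onlyExceedEvent (h : ExpFamily P ξ l) (a : ℕ) (n : Fin A → ℕ)
    {i : Fin A} (hi : i ∈ firstAgents A a) :
    P.real (onlyExceedEvent a ξ n i) =
      ∫ ω, (∏ j ∈ (firstAgents A a).erase i, (survival P (ξ j) (minTotal a ξ ω).toReal -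
          gapProb P (ξ j) (n j) (minTotal a ξ ω).toReal)) *
        gapProb P (ξ i) (n i) (minTotal a ξ ω).toReal ∂P := by
  simp_rw [← fun j => (h.row j).measureReal_le_partialSum]
  rw [show (∫ ω, (∏ j ∈ (firstAgents A a).erase i, P.real {ω' | ¬ partialSum (ξ j) (n j) ω' <
      (minTotal a ξ ω).toReal ∧ ENNReal.ofReal (minTotal a ξ ω).toReal < totalTime (ξ j) ω'}) *
      gapProb P (ξ i) (n i) (minTotal a ξ ω).toReal ∂P) = _ from
    (h.measureReal_and_forall_erase a (B := fun j => (exceedSet (n j))ᶜ ∩ surviveSet)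
      (C := exceedSet (n i) ∩ surviveSet)
      (fun j => (measurableSet_exceedSet (n j)).compl.inter measurableSet_surviveSet)
      ((measurableSet_exceedSet (n i)).inter measurableSet_surviveSet) hi).symm]
  congr 1
  ext ω
  change (_ ∧ (∀ j ∈ firstAgents A a, _)) ∧ (∀ j ∈ (firstAgents A a).erase i, _) ↔
    (_ ∧ _) ∧ (∀ j ∈ (firstAgents A a).erase i, _ ∧ _)
  rw [forall_firstAgents_iff hi, forall₂_and, and_comm (a := ∀ j ∈ (firstAgents A a).erase i, _)]
  simp only [and_assoc]
  rfl

variable {a : ℕ}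

theorem ExpFamily.tendsto_exceedEvent_div (h : ExpFamily P ξ l)
    (hS0 : ∀ᵐ ω ∂P, 0 < (minTotal a ξ ω).toReal) {i : Fin A} (hi : i ∈ firstAgents A a)
    (hs : Summable fun k => 1 / l i k) {n : ℕ → ℕ} (hn : Tendsto n atTop atTop) :
    Tendsto (fun x => P.real (exceedEvent a ξ (n x) i) / ∑' k, 1 / l i (k + n x)) atTop
      (𝓝 (∫ ω, (∏ j ∈ (firstAgents A a).erase i, survival P (ξ j) (minTotal a ξ ω).toReal) *
        totalDensity P (ξ i) (l i) (minTotal a ξ ω).toReal ∂P)) := by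
  have hS := (h.measurable_minTotal a).ennreal_toReal
  simp_rw [h.measureReal_exceedEvent a _ hi]
  exact (h.row i).tendsto_integral_gapProb_div hs hS hS0 hn
    (fun _ => Finset.measurable_fun_prod _ fun j _ => (h.row j).measurable_survival.comp hS)
    (fun _ ω => Finset.prod_nonneg fun j _ => survival_nonneg _ _)
    (fun _ ω => Finset.prod_le_one (fun j _ => survival_nonneg _ _) fun j _ => survival_le_one _ _)
    (ae_of_all _ fun ω => tendsto_const_nhds)

/-- The limit is that of `exceedEvent`: forbidding the others to exceed subtracts their gap
probabilities, which vanish in the limit. -/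
theorem ExpFamily.tendsto_onlyExceedEvent_div (h : ExpFamily P ξ l)
    (hS0 : ∀ᵐ ω ∂P, 0 < (minTotal a ξ ω).toReal) {i : Fin A} (hi : i ∈ firstAgents A a)
    (hs : ∀ i ∈ firstAgents A a, Summable fun k => 1 / l i k) {n : ℕ → Fin A → ℕ}
    (hn : ∀ i, Tendsto (fun x => n x i) atTop atTop) :
    Tendsto (fun x => P.real (onlyExceedEvent a ξ (n x) i) / ∑' k, 1 / l i (k + n x i)) atTop
      (𝓝 (∫ ω, (∏ j ∈ (firstAgents A a).erase i, survival P (ξ j) (minTotal a ξ ω).toReal) *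
        totalDensity P (ξ i) (l i) (minTotal a ξ ω).toReal ∂P)) := by
  have hS := (h.measurable_minTotal a).ennreal_toReal
  simp_rw [h.measureReal_onlyExceedEvent a _ hi]
  refine (h.row i).tendsto_integral_gapProb_div (hs i hi) hS hS0 (hn i)
    (fun x => Finset.measurable_fun_prod _ fun j _ =>
      ((h.row j).measurable_survival.comp hS).sub (((h.row j).measurable_gapProb (n x j)).comp hS))
    (fun _ ω => Finset.prod_nonneg fun j _ => sub_nonneg.2 (gapProb_le_survival _ _ _))
    (fun _ ω => Finset.prod_le_one (fun j _ => sub_nonneg.2 (gapProb_le_survival _ _ _)) fun j _ =>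
      (sub_le_self _ (gapProb_nonneg _ _ _)).trans (survival_le_one _ _)) ?_
  filter_upwards [hS0] with ω hω
  refine tendsto_finsetProd _ fun j hj => ?_
  simpa using (((h.row j).tendsto_gapProb_zero (hs j (Finset.mem_of_mem_erase hj)) hω).comp
    (hn j)).const_sub (survival P (ξ j) (minTotal a ξ ω).toReal)

theorem ExpFamily.tendsto_iInter_exceedEvent_div (h : ExpFamily P ξ l)
    (hS0 : ∀ᵐ ω ∂P, 0 < (minTotal a ξ ω).toReal)
    (hs : ∀ i ∈ firstAgents A a, Summable fun k => 1 / l i k) {n : ℕ → Fin A → ℕ}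
    (hn : ∀ i, Tendsto (fun x => n x i) atTop atTop) :
    Tendsto (fun x => P.real {ω | (∀ i ∈ firstAgents A a,
        partialSum (ξ i) (n x i) ω < (minTotal a ξ ω).toReal) ∧ ω ∈ lossEvent a ξ} /
          ∏ i ∈ firstAgents A a, ∑' k, 1 / l i (k + n x i)) atTop
      (𝓝 (∫ ω, ∏ i ∈ firstAgents A a,
        totalDensity P (ξ i) (l i) (minTotal a ξ ω).toReal ∂P)) := by
  have hS := (h.measurable_minTotal a).ennreal_toReal
  simp_rw [h.measureReal_iInter_exceedEvent a, ← integral_div, ← Finset.prod_div_distrib]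
  refine tendsto_integral_filter_of_dominated_convergence
    (fun _ => ∏ i ∈ firstAgents A a, l i 0)
    (Eventually.of_forall fun x => ?_) ?_ (integrable_const _) ?_
  · exact (Finset.measurable_fun_prod _ fun i _ =>
      (((h.row i).measurable_gapProb (n x i)).comp hS).div_const _).aestronglyMeasurable
  · filter_upwards [(Finset.eventually_all (firstAgents A a)).2 fun i _ =>
      (hn i).eventually (eventually_ge_atTop 1)] with x hx
    filter_upwards [hS0] with ω hω
    have h0 : ∀ i ∈ firstAgents A a, 0 ≤ gapProb P (ξ i) (n x i) (minTotal a ξ ω).toReal /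
        ∑' k, 1 / l i (k + n x i) := fun i hi =>
      div_nonneg (gapProb_nonneg _ _ _) ((h.row i).tsum_pos (hs i hi) _).le
    rw [Real.norm_eq_abs, abs_of_nonneg (Finset.prod_nonneg h0)]
    refine Finset.prod_le_prod h0 fun i hi => ?_
    rw [div_le_iff₀ ((h.row i).tsum_pos (hs i hi) _)]
    have := hx i hi
    exact (h.row i).gapProb_le (hs i hi) (by omega) hω
  · filter_upwards [hS0] with ω hω
    exact tendsto_finsetProd _ fun i hi => ((h.row i).tendsto_gapProb_div (hs i hi) hω).comp (hn i)

end LossEvents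

/-! ### The losing agents of the urn -/

section Deterministic

/-- If at most one term exceeds `η / I.card * x` and none exceeds `(1 - η) * x`, the small terms add
up to at most `η * x` and the total to at most `x`. -/
theorem exists_lt_floor_of_lt_sum {ι : Type*} [DecidableEq ι] {I : Finset ι} {X : ι → ℕ∞} {x : ℕ}
    (h : (x : ℕ∞) < ∑ i ∈ I, X i) {η : ℝ} (hη : 0 < η) (hη1 : η < 1) :
    (∃ i ∈ I, (⌊(1 - η) * x⌋₊ : ℕ∞) < X i) ∨
      ∃ i ∈ I, (⌊η / I.card * x⌋₊ : ℕ∞) < X i ∧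
        ∃ j ∈ I.erase i, (⌊η / I.card * x⌋₊ : ℕ∞) < X j := by
  by_contra! hcon
  obtain ⟨h1, h2⟩ := hcon
  have hne : I.Nonempty := by
    by_contra hI
    rw [Finset.not_nonempty_iff_eq_empty] at hI
    simp [hI] at h
  have hcard : (1 : ℝ) ≤ I.card := by exact_mod_cast hne.card_pos
  have hfin : ∀ i ∈ I, X i = ((X i).toNat : ℕ∞) := fun i hi =>
    (ENat.natCast_toNat (ne_top_of_le_ne_top (ENat.natCast_ne_top _) (h1 i hi))).symm
  have hcast : ∀ {i : ι} {y : ℝ}, i ∈ I → 0 ≤ y → X i ≤ (⌊y⌋₊ : ℕ∞) → ((X i).toNat : ℝ) ≤ y := by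
    intro i y hi hy hle
    rw [hfin i hi] at hle
    exact (Nat.le_floor_iff hy).1 (by exact_mod_cast hle)
  have hx : (0 : ℝ) ≤ x := Nat.cast_nonneg x
  have hδ : 0 ≤ η / I.card * x := by positivity
  have h7 : (I.card : ℝ) * (η / I.card * x) = η * x := by
    rw [← mul_assoc, ← mul_div_assoc, mul_div_cancel_left₀ _ (by linarith)]
  have hsum : (x : ℝ) < ∑ i ∈ I, ((X i).toNat : ℝ) := by
    rw [Finset.sum_congr rfl hfin] at h
    exact_mod_cast h
  refine absurd hsum (not_lt.2 ?_)
  by_cases hex : ∃ i ∈ I, (⌊η / I.card * x⌋₊ : ℕ∞) < X i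
  · obtain ⟨i, hi, hlt⟩ := hex
    rw [← Finset.add_sum_erase _ _ hi]
    have h3 := hcast hi (mul_nonneg (by linarith) hx) (h1 i hi)
    have h4 : ∑ j ∈ I.erase i, ((X j).toNat : ℝ) ≤ (I.erase i).card • (η / I.card * x) :=
      Finset.sum_le_card_nsmul _ _ _ fun j hj =>
        hcast (Finset.mem_of_mem_erase hj) hδ (h2 i hi hlt j hj)
    have h5 : ((I.erase i).card : ℝ) ≤ I.card := by exact_mod_cast Finset.card_erase_le
    have h6 : ((I.erase i).card : ℝ) * (η / I.card * x) ≤ I.card * (η / I.card * x) :=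
      mul_le_mul_of_nonneg_right h5 hδ
    rw [nsmul_eq_mul] at h4
    linarith
  · push Not at hex
    have h4 : ∑ j ∈ I, ((X j).toNat : ℝ) ≤ I.card • (η / I.card * x) :=
      Finset.sum_le_card_nsmul _ _ _ fun j hj => hcast hj hδ (hex j hj)
    rw [nsmul_eq_mul, h7] at h4
    nlinarith

variable {Ω : Type*} {A : ℕ}

/-- The sojourn times of each agent, from the initial value of the agent on. -/
def rows (τ : Ω → Fin A → ℕ → ℝ) (x₀ : Fin A → ℕ) (i : Fin A) (k : ℕ) (ω : Ω) : ℝ :=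
  τ ω i (x₀ i + k)

/-- The almost sure properties of the sojourn times on which the path analysis relies. -/
structure IsRegularPath (a : ℕ) (σ : Fin A → ℕ → ℝ) (x₀ : Fin A → ℕ) : Prop where
  pos : ∀ i k, 0 < σ i (x₀ i + k)
  lt_top : minOtherExplosion a σ x₀ < ∞
  ne : ∀ i ∈ firstAgents A a, ∀ j, j ≠ i → explosionTime (σ i) (x₀ i) ≠ explosionTime (σ j) (x₀ j)

variable {a : ℕ} {τ : Ω → Fin A → ℕ → ℝ} {x₀ : Fin A → ℕ} {ω : Ω}

theorem IsRegularPath.ofReal_toReal (h : IsRegularPath a (τ ω) x₀) :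
    ENNReal.ofReal (minTotal a (rows τ x₀) ω).toReal = minOtherExplosion a (τ ω) x₀ :=
  ENNReal.ofReal_toReal h.lt_top.ne

theorem IsRegularPath.mem_allLose_iff (h : IsRegularPath a (τ ω) x₀) :
    ω ∈ allLose a τ x₀ ↔ ω ∈ lossEvent a (rows τ x₀) := by
  refine (forall_not_strongMonopoly_iff h.pos h.lt_top h.ne).trans ?_
  simp only [lossEvent, Set.mem_ofPred_eq, h.ofReal_toReal]
  rfl

theorem IsRegularPath.lt_urnLimit_iff (h : IsRegularPath a (τ ω) x₀)
    (hloss : ω ∈ lossEvent a (rows τ x₀)) {i : Fin A} {x : ℕ} (hx : x₀ i ≤ x) :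
    (x : ℕ∞) < urnLimit (τ ω) x₀ i ↔
      partialSum (rows τ x₀ i) (x + 1 - x₀ i) ω < (minTotal a (rows τ x₀) ω).toReal := by
  have hloss' : ∀ i ∈ firstAgents A a,
      minOtherExplosion a (τ ω) x₀ < explosionTime (τ ω i) (x₀ i) := fun i hi => by
    rw [← h.ofReal_toReal]; exact hloss i hi
  have hfin := (minExplosion_le_minOtherExplosion (σ := τ ω) (x₀ := x₀) a).trans_lt h.lt_top
  rw [PolyaUrn.lt_urnLimit_iff h.pos hfin, minExplosion_eq_minOtherExplosion hloss',
    ENNReal.ofReal_lt_iff_lt_toReal (jumpSum_nonneg (h.pos i) x) h.lt_top.ne]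
  -- Leaving state `x` takes the sojourns in `x₀ i, …, x`, which are `x + 1 - x₀ i` many.
  obtain ⟨d, rfl⟩ := Nat.exists_eq_add_of_le hx
  rw [jumpSum_add, add_assoc, Nat.add_sub_cancel_left]
  rfl

theorem IsRegularPath.mem_exceedEvent_iff (h : IsRegularPath a (τ ω) x₀) {i : Fin A} {x : ℕ}
    (hx : x₀ i ≤ x) :
    ω ∈ exceedEvent a (rows τ x₀) (x + 1 - x₀ i) i ↔
      (x : ℕ∞) < urnLimit (τ ω) x₀ i ∧ ω ∈ allLose a τ x₀ := by
  rw [h.mem_allLose_iff]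
  exact and_congr_left fun hloss => (h.lt_urnLimit_iff hloss hx).symm

theorem IsRegularPath.lt_inf_iff (h : IsRegularPath a (τ ω) x₀) {x : ℕ}
    (hx : ∀ i, x₀ i ≤ x) :
    (x : ℕ∞) < (firstAgents A a).inf (fun i => urnLimit (τ ω) x₀ i) ∧ ω ∈ allLose a τ x₀ ↔
      (∀ i ∈ firstAgents A a, partialSum (rows τ x₀ i) (x + 1 - x₀ i) ω <
        (minTotal a (rows τ x₀) ω).toReal) ∧ ω ∈ lossEvent a (rows τ x₀) := by
  rw [h.mem_allLose_iff]
  refine and_congr_left fun hloss => ?_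
  rw [Finset.lt_inf_iff (ENat.natCast_lt_top x)]
  exact forall₂_congr fun i _ => h.lt_urnLimit_iff hloss (hx i)

theorem IsRegularPath.lt_sup_iff (h : IsRegularPath a (τ ω) x₀) {x : ℕ}
    (hx : ∀ i, x₀ i ≤ x) :
    (x : ℕ∞) < (firstAgents A a).sup (fun i => urnLimit (τ ω) x₀ i) ∧ ω ∈ allLose a τ x₀ ↔
      ω ∈ ⋃ i ∈ firstAgents A a, exceedEvent a (rows τ x₀) (x + 1 - x₀ i) i := by
  simp only [Finset.lt_sup_iff, Set.mem_iUnion, h.mem_exceedEvent_iff (hx _)]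
  tauto

theorem IsRegularPath.lt_sum_of_mem (h : IsRegularPath a (τ ω) x₀) {x : ℕ}
    (hx : ∀ i, x₀ i ≤ x)
    (hω : ω ∈ ⋃ i ∈ firstAgents A a, exceedEvent a (rows τ x₀) (x + 1 - x₀ i) i) :
    (x : ℕ∞) < ∑ i ∈ firstAgents A a, urnLimit (τ ω) x₀ i ∧ ω ∈ allLose a τ x₀ := by
  simp only [Set.mem_iUnion, h.mem_exceedEvent_iff (hx _)] at hω
  obtain ⟨i, hi, hlt, hl⟩ := hω
  exact ⟨hlt.trans_le (Finset.single_le_sum (f := fun i => urnLimit (τ ω) x₀ i)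
    (fun _ _ => zero_le) hi), hl⟩

theorem IsRegularPath.mem_of_lt_sum (h : IsRegularPath a (τ ω) x₀) {x : ℕ} {η : ℝ} (hη : 0 < η)
    (hη1 : η < 1) (hx : ∀ i, x₀ i ≤ ⌊(1 - η) * x⌋₊)
    (hx' : ∀ i, x₀ i ≤ ⌊η / (firstAgents A a).card * x⌋₊)
    (hlt : (x : ℕ∞) < ∑ i ∈ firstAgents A a, urnLimit (τ ω) x₀ i) (hl : ω ∈ allLose a τ x₀) :
    ω ∈ (⋃ i ∈ firstAgents A a, exceedEvent a (rows τ x₀) (⌊(1 - η) * x⌋₊ + 1 - x₀ i) i) ∪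
      ⋃ i ∈ firstAgents A a,
        (exceedEvent a (rows τ x₀) (⌊η / (firstAgents A a).card * x⌋₊ + 1 - x₀ i) i \
          onlyExceedEvent a (rows τ x₀)
            (fun i => ⌊η / (firstAgents A a).card * x⌋₊ + 1 - x₀ i) i) := by
  rcases exists_lt_floor_of_lt_sum hlt hη hη1 with ⟨i, hi, h1⟩ | ⟨i, hi, h1, j, hj, h2⟩
  · exact Or.inl (Set.mem_biUnion hi ((h.mem_exceedEvent_iff (hx i)).2 ⟨h1, hl⟩))
  · refine Or.inr (Set.mem_biUnion hi ⟨(h.mem_exceedEvent_iff (hx' i)).2 ⟨h1, hl⟩, fun honly => ?_⟩)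
    exact honly.2 j hj ((h.lt_urnLimit_iff (h.mem_allLose_iff.1 hl) (hx' j)).1 h2)

end Deterministic

/-! ### Measure bounds for the sandwich -/

section Bounds

variable {Ω : Type*} [MeasurableSpace Ω] {P : Measure Ω} [IsProbabilityMeasure P] {A : ℕ}
  {ξ : Fin A → ℕ → Ω → ℝ} {l : Fin A → ℕ → ℝ}

/-- At most one agent can be the only one to exceed, so these events are disjoint parts of the
union. -/
theorem ExpFamily.sum_onlyExceedEvent_le (h : ExpFamily P ξ l) (a : ℕ) (n : Fin A → ℕ) :
    ∑ i ∈ firstAgents A a, P.real (onlyExceedEvent a ξ n i) ≤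
      P.real (⋃ i ∈ firstAgents A a, exceedEvent a ξ (n i) i) := by
  rw [← measureReal_biUnion_finset ?_ fun i _ => h.measurableSet_onlyExceedEvent a n i]
  · exact measureReal_mono (Set.iUnion₂_mono fun i _ => Set.inter_subset_left)
      (measure_ne_top _ _)
  · intro i hi j hj hij
    refine Set.disjoint_left.2 fun ω hω hω' => ?_
    exact hω.2 j (Finset.mem_erase.2 ⟨hij.symm, hj⟩) hω'.1.1

theorem ExpFamily.measureReal_exceedEvent_diff (h : ExpFamily P ξ l) (a : ℕ) (n : Fin A → ℕ)
    (i : Fin A) :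
    P.real (exceedEvent a ξ (n i) i \ onlyExceedEvent a ξ n i) =
      P.real (exceedEvent a ξ (n i) i) - P.real (onlyExceedEvent a ξ n i) :=
  measureReal_sdiff Set.inter_subset_left (h.measurableSet_onlyExceedEvent a n i)

theorem integral_pos_of_ae_pos {f : Ω → ℝ} (hf : Integrable f P) (hpos : ∀ᵐ ω ∂P, 0 < f ω) :
    0 < ∫ ω, f ω ∂P := by
  rw [integral_pos_iff_support_of_nonneg_ae (hpos.mono fun ω hω => hω.le) hf]
  have hsupp : Function.support f =ᵐ[P] Set.univ :=
    eventuallyEq_univ.2 (hpos.mono fun ω hω => hω.ne')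
  rw [measure_congr hsupp, measure_univ]
  exact one_pos

end Bounds

/-! ### From the sojourn times of the urn to families of exponential rows -/

section UrnAsymptotics

variable {Ω : Type*} [MeasurableSpace Ω] {P : Measure Ω} {A : ℕ} {F : Fin A → ℕ → ℝ}
  {x₀ : Fin A → ℕ} {τ : Ω → Fin A → ℕ → ℝ}

theorem expFamily_rows (hF : ∀ i k, 1 ≤ k → 0 < F i k) (hx₀ : ∀ i, 1 ≤ x₀ i)
    (hτ_meas : ∀ i k, 1 ≤ k → Measurable fun ω => τ ω i k)
    (hτ_law : ∀ i k, 1 ≤ k → P.map (fun ω => τ ω i k) = expMeasure (F i k))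
    (hτ_indep : iIndepFun (fun (p : Fin A × ℕ) (ω : Ω) => τ ω p.1 (p.2 + 1)) P) :
    ExpFamily P (rows τ x₀) (fun i k => F i (x₀ i + k)) := by
  have hpos : ∀ i k, 1 ≤ x₀ i + k := fun i k => (hx₀ i).trans (Nat.le_add_right _ _)
  have hmeas : ∀ i k, Measurable (rows τ x₀ i k) := fun i k => hτ_meas i _ (hpos i k)
  have hind : iIndepFun (fun p : Fin A × ℕ => rows τ x₀ p.1 p.2) P := by
    -- Independence is indexed by the state minus one, so entry `k` of row `i` has index `x₀ i + k -
    -- 1`.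
    have hinj : Function.Injective fun p : Fin A × ℕ => (p.1, x₀ p.1 + p.2 - 1) := by
      rintro ⟨i, k⟩ ⟨j, m⟩ hij
      simp only [Prod.mk.injEq] at hij ⊢
      obtain ⟨rfl, hkm⟩ := hij
      have h1 := hpos i k
      have h2 := hpos i m
      exact ⟨rfl, by omega⟩
    have h := hτ_indep.precomp hinj
    have heq : (fun p : Fin A × ℕ => rows τ x₀ p.1 p.2) =
        fun p ω => τ ω p.1 (x₀ p.1 + p.2 - 1 + 1) := by
      funext p ω
      rw [Nat.sub_add_cancel (hpos p.1 p.2)]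
      rfl
    rw [heq]
    exact h
  exact
    { row := fun i =>
        { rate_pos := fun k => hF i _ (hpos i k)
          meas := hmeas i
          law := fun k => hτ_law i _ (hpos i k)
          indep := hind.precomp (g := fun k => (i, k)) fun k m hkm => (Prod.mk.inj hkm).2 }
      indep := iIndepFun_rows hmeas hind }

theorem ExplosionCriterion.summable_rates {f : ℕ → ℝ} (hs : ExplosionCriterion f) {m : ℕ}
    (hm : 1 ≤ m) : Summable fun k => 1 / f (m + k) := by
  have := hs.summable_shift (m - 1)
  rwa [Nat.sub_add_cancel hm] at this

theorem tsum_rates_eq_tailSum (f : ℕ → ℝ) {m x : ℕ} (hmx : m ≤ x) :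
    ∑' k, 1 / f (m + (k + (x + 1 - m))) = tailSum f x := by
  refine tsum_congr fun k => ?_
  rw [show m + (k + (x + 1 - m)) = x + 1 + k by omega]

theorem measurable_explosionDensity (i : Fin A) : Measurable (explosionDensity P τ x₀ i) :=
  measurable_deriv _

variable [IsProbabilityMeasure P] {a : ℕ}

theorem ae_isRegularPath (h : ExpFamily P (rows τ x₀) (fun i k => F i (x₀ i + k)))
    (hs : ∀ i ∈ firstAgents A a, Summable fun k => 1 / F i (x₀ i + k))
    {j : Fin A} (hj : a ≤ j.val) (hsj : Summable fun k => 1 / F j (x₀ j + k)) :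
    ∀ᵐ ω ∂P, IsRegularPath a (τ ω) x₀ := by
  have hne : ∀ᵐ ω ∂P, ∀ i j, i ∈ firstAgents A a → j ≠ i →
      totalTime (rows τ x₀ i) ω ≠ totalTime (rows τ x₀ j) ω :=
    ae_all_iff.2 fun i => ae_all_iff.2 fun j => by
      by_cases hij : i ∈ firstAgents A a ∧ j ≠ i
      · filter_upwards [h.ae_totalTime_ne (hs i hij.1) hij.2] with ω hω _ _ using hω
      · exact ae_of_all _ fun ω h1 h2 => absurd ⟨h1, h2⟩ hij
  filter_upwards [ae_all_iff.2 fun i => (h.row i).ae_pos, h.ae_minTotal_lt_top hj hsj, hne]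
    with ω h1 h2 h3
  exact ⟨h1, h2, fun i hi j hj => h3 i j hi hj⟩

theorem explosionDensity_eq (h : ExpFamily P (rows τ x₀) (fun i k => F i (x₀ i + k))) {i : Fin A}
    (hs : Summable fun k => 1 / F i (x₀ i + k)) {t : ℝ} (ht : 0 < t) :
    explosionDensity P τ x₀ i t =
      totalDensity P (rows τ x₀ i) (fun k => F i (x₀ i + k)) t :=
  ((h.row i).hasDerivAt_totalTime hs ht).deriv

theorem tendsto_add_one_sub (m : ℕ) : Tendsto (fun x => x + 1 - m) atTop atTop :=
  (tendsto_sub_atTop_nat m).comp (tendsto_add_atTop_nat 1)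

end UrnAsymptotics

end PolyaUrn

/-! ### The three asymptotic equivalences -/

open PolyaUrn in
theorem mainTheorem9 {Ω : Type*} [MeasurableSpace Ω] (P : Measure Ω) [IsProbabilityMeasure P]
    (A a : ℕ) (ha : 1 ≤ a) (haA : a < A)
    (F : Fin A → ℕ → ℝ) (hF : ∀ i k, 1 ≤ k → 0 < F i k)
    (x₀ : Fin A → ℕ) (hx₀ : ∀ i, 1 ≤ x₀ i)
    (τ : Ω → Fin A → ℕ → ℝ)
    (hτ_meas : ∀ i k, 1 ≤ k → Measurable fun ω => τ ω i k)
    (hτ_law : ∀ i k, 1 ≤ k → P.map (fun ω => τ ω i k) = expMeasure (F i k))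
    (hτ_indep : iIndepFun (fun (p : Fin A × ℕ) (ω : Ω) => τ ω p.1 (p.2 + 1)) P)
    (hexp : ∀ i : Fin A, i.val < a → PolyaUrn.ExplosionCriterion (F i))
    (hexp' : ∃ j : Fin A, a ≤ j.val ∧ PolyaUrn.ExplosionCriterion (F j)) :
    -- all quantities below are well defined
    0 < P.real (PolyaUrn.allLose a τ x₀) ∧
    (∀ i ∈ PolyaUrn.firstAgents A a, ∀ t : ℝ, 0 < t →
      DifferentiableAt ℝ (PolyaUrn.explosionCdf P τ x₀ i) t) ∧
    Integrable (PolyaUrn.minIntegrand P a τ x₀) P ∧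
    (∀ i ∈ PolyaUrn.firstAgents A a, Integrable (PolyaUrn.maxIntegrand P a τ x₀ i) P) ∧
    -- the minimum
    PolyaUrn.AsympEquiv
      (fun x : ℕ => PolyaUrn.condProb P (PolyaUrn.allLose a τ x₀)
        {ω | (x : ℕ∞) < (PolyaUrn.firstAgents A a).inf
          fun i => PolyaUrn.urnLimit (τ ω) x₀ i})
      (fun x : ℕ => (∫ ω, PolyaUrn.minIntegrand P a τ x₀ ω ∂P) /
          P.real (PolyaUrn.allLose a τ x₀) *
        ∏ i ∈ PolyaUrn.firstAgents A a, PolyaUrn.tailSum (F i) x) ∧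
    -- the maximum
    PolyaUrn.AsympEquiv
      (fun x : ℕ => PolyaUrn.condProb P (PolyaUrn.allLose a τ x₀)
        {ω | (x : ℕ∞) < (PolyaUrn.firstAgents A a).sup
          fun i => PolyaUrn.urnLimit (τ ω) x₀ i})
      (fun x : ℕ => ∑ i ∈ PolyaUrn.firstAgents A a,
        (∫ ω, PolyaUrn.maxIntegrand P a τ x₀ i ω ∂P) /
          P.real (PolyaUrn.allLose a τ x₀) * PolyaUrn.tailSum (F i) x) ∧
    -- the sum, for regularly varying feedback
    ((∀ i ∈ PolyaUrn.firstAgents A a, PolyaUrn.RegularlyVarying (F i)) →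
      PolyaUrn.AsympEquiv
        (fun x : ℕ => PolyaUrn.condProb P (PolyaUrn.allLose a τ x₀)
          {ω | (x : ℕ∞) < ∑ i ∈ PolyaUrn.firstAgents A a,
            PolyaUrn.urnLimit (τ ω) x₀ i})
        (fun x : ℕ => ∑ i ∈ PolyaUrn.firstAgents A a,
          (∫ ω, PolyaUrn.maxIntegrand P a τ x₀ i ω ∂P) /
            P.real (PolyaUrn.allLose a τ x₀) * PolyaUrn.tailSum (F i) x)) := by
  have h := expFamily_rows hF hx₀ hτ_meas hτ_law hτ_indep
  have hexpI : ∀ i ∈ firstAgents A a, ExplosionCriterion (F i) := fun i hi =>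
    hexp i (mem_firstAgents.1 hi)
  have hs : ∀ i ∈ firstAgents A a, Summable fun k => 1 / F i (x₀ i + k) := fun i hi =>
    (hexpI i hi).summable_rates (hx₀ i)
  have hI : (firstAgents A a).Nonempty := ⟨⟨0, by omega⟩, mem_firstAgents.2 ha⟩
  obtain ⟨j₀, hj₀, hj₀exp⟩ := hexp'
  have hreg := ae_isRegularPath h hs hj₀ (hj₀exp.summable_rates (hx₀ j₀))
  have hSm : Measurable fun ω => (minTotal a (rows τ x₀) ω).toReal :=
    (h.measurable_minTotal a).ennreal_toReal
  have hS0 : ∀ᵐ ω ∂P, 0 < (minTotal a (rows τ x₀) ω).toReal := by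
    filter_upwards [h.ae_minTotal_pos haA, hreg] with ω h1 h2
    exact ENNReal.toReal_pos h1.ne' h2.lt_top.ne
  have hsurv_meas : ∀ i, Measurable fun ω =>
      survival P (rows τ x₀ i) (minTotal a (rows τ x₀) ω).toReal := fun i =>
    (h.row i).measurable_survival.comp hSm
  have hdens_meas : ∀ i, Measurable fun ω =>
      explosionDensity P τ x₀ i (minTotal a (rows τ x₀) ω).toReal := fun i =>
    (measurable_explosionDensity i).comp hSm
  -- the losing event
  have hE_eq : P.real (allLose a τ x₀) = P.real (lossEvent a (rows τ x₀)) := by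
    refine measureReal_congr ?_
    filter_upwards [hreg] with ω hω using propext hω.mem_allLose_iff
  have hE : 0 < P.real (allLose a τ x₀) := by
    rw [hE_eq, h.measureReal_lossEvent]
    refine integral_pos_of_ae_pos (Integrable.of_bound
      (Finset.measurable_fun_prod _ fun i _ => hsurv_meas i).aestronglyMeasurable 1
      (ae_of_all _ fun ω => ?_)) ?_
    · rw [Real.norm_eq_abs, abs_of_nonneg (Finset.prod_nonneg fun i _ => survival_nonneg _ _)]
      exact Finset.prod_le_one (fun i _ => survival_nonneg _ _) fun i _ => survival_le_one _ _
    · filter_upwards [hS0] with ω hω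
      exact Finset.prod_pos fun i _ => (h.row i).survival_pos hω
  -- the integrands
  have hmin_ae : ∀ᵐ ω ∂P, minIntegrand P a τ x₀ ω = ∏ i ∈ firstAgents A a,
      totalDensity P (rows τ x₀ i) (fun k => F i (x₀ i + k))
        (minTotal a (rows τ x₀) ω).toReal := by
    filter_upwards [hS0] with ω hω
    exact Finset.prod_congr rfl fun i hi => explosionDensity_eq h (hs i hi) hω
  have hmin_int : Integrable (minIntegrand P a τ x₀) P := by
    refine Integrable.of_bound (Finset.measurable_fun_prod _
      fun i _ => hdens_meas i).aestronglyMeasurable (∏ i ∈ firstAgents A a, F i (x₀ i + 0)) ?_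
    filter_upwards [hmin_ae] with ω hω
    have h0 : ∀ i ∈ firstAgents A a, 0 ≤ totalDensity P (rows τ x₀ i) (fun k => F i (x₀ i + k))
        (minTotal a (rows τ x₀) ω).toReal := fun i _ =>
      integral_expDensity_nonneg ((h.row i).rate_pos 0) _ _
    rw [hω, Real.norm_eq_abs, abs_of_nonneg (Finset.prod_nonneg h0)]
    exact Finset.prod_le_prod h0 fun i _ => (h.row i).totalDensity_le _
  have hmin_pos : 0 < ∫ ω, minIntegrand P a τ x₀ ω ∂P := by
    refine integral_pos_of_ae_pos hmin_int ?_
    filter_upwards [hmin_ae, hS0] with ω hω hω0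
    rw [hω]
    exact Finset.prod_pos fun i hi => (h.row i).totalDensity_pos (hs i hi) hω0
  have hmax_ae : ∀ i ∈ firstAgents A a, ∀ᵐ ω ∂P, maxIntegrand P a τ x₀ i ω =
      (∏ j ∈ (firstAgents A a).erase i,
        survival P (rows τ x₀ j) (minTotal a (rows τ x₀) ω).toReal) *
      totalDensity P (rows τ x₀ i) (fun k => F i (x₀ i + k))
        (minTotal a (rows τ x₀) ω).toReal := fun i hi => by
    filter_upwards [hS0] with ω hω
    rw [← explosionDensity_eq h (hs i hi) hω]
    rfl
  have hmax_int : ∀ i ∈ firstAgents A a, Integrable (maxIntegrand P a τ x₀ i) P := fun i hi => by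
    refine (h.row i).integrable_totalDensity_comp_mul
      (S := fun ω => (minTotal a (rows τ x₀) ω).toReal)
      (g := fun ω => explosionDensity P τ x₀ i (minTotal a (rows τ x₀) ω).toReal)
      (q := fun ω => ∏ j ∈ (firstAgents A a).erase i,
        survival P (rows τ x₀ j) (minTotal a (rows τ x₀) ω).toReal)
      (hdens_meas i).aestronglyMeasurable ?_
      (Finset.measurable_fun_prod _ fun j _ => hsurv_meas j).aestronglyMeasurable
      (fun ω => Finset.prod_nonneg fun j _ => survival_nonneg _ _)
      (fun ω => Finset.prod_le_one (fun j _ => survival_nonneg _ _) fun j _ => survival_le_one _ _)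
    filter_upwards [hS0] with ω hω using explosionDensity_eq h (hs i hi) hω
  have hmax_pos : ∀ i ∈ firstAgents A a, 0 < ∫ ω, maxIntegrand P a τ x₀ i ω ∂P := fun i hi => by
    refine integral_pos_of_ae_pos (hmax_int i hi) ?_
    filter_upwards [hmax_ae i hi, hS0] with ω hω hω0
    rw [hω]
    exact mul_pos (Finset.prod_pos fun j _ => (h.row j).survival_pos hω0)
      ((h.row i).totalDensity_pos (hs i hi) hω0)
  -- asymptotics of the elementary events
  have hr : ∀ i ∈ firstAgents A a, ∀ x, 0 < tailSum (F i) x := fun i hi x =>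
    tailSum_pos (hF i) (hexpI i hi) x
  -- Beyond all initial values the truncated subtraction `x + 1 - x₀ i` is a true one.
  have hlarge : ∀ᶠ x : ℕ in atTop, ∀ i, x₀ i ≤ x :=
    eventually_all.2 fun i => eventually_ge_atTop (x₀ i)
  have hn : ∀ i, Tendsto (fun x => x + 1 - x₀ i) atTop atTop := fun i => tendsto_add_one_sub _
  -- `U` overcounts joint exceedances and `V` omits them; their common limit closes the sandwich.
  set U : Fin A → ℕ → ℝ := fun i x => P.real (exceedEvent a (rows τ x₀) (x + 1 - x₀ i) i) with hUdef
  set V : Fin A → ℕ → ℝ := fun i x =>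
    P.real (onlyExceedEvent a (rows τ x₀) (fun i => x + 1 - x₀ i) i) with hVdef
  have hU : ∀ i ∈ firstAgents A a, Tendsto (fun x => U i x / tailSum (F i) x) atTop
      (𝓝 (∫ ω, maxIntegrand P a τ x₀ i ω ∂P)) := fun i hi => by
    rw [integral_congr_ae (hmax_ae i hi)]
    refine (h.tendsto_exceedEvent_div hS0 hi (hs i hi) (hn i)).congr' ?_
    filter_upwards [hlarge] with x hx
    rw [tsum_rates_eq_tailSum (F i) (hx i)]
  have hV : ∀ i ∈ firstAgents A a, Tendsto (fun x => V i x / tailSum (F i) x) atTop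
      (𝓝 (∫ ω, maxIntegrand P a τ x₀ i ω ∂P)) := fun i hi => by
    rw [integral_congr_ae (hmax_ae i hi)]
    refine (h.tendsto_onlyExceedEvent_div hS0 hi hs
      (n := fun x i => x + 1 - x₀ i) hn).congr' ?_
    filter_upwards [hlarge] with x hx
    rw [tsum_rates_eq_tailSum (F i) (hx i)]
  -- The probability of the losing event cancels, so unconditional probabilities suffice.
  have hcond : ∀ B : ℕ → Set Ω,
      Tendsto (fun x => P.real (B x ∩ allLose a τ x₀) / ∑ i ∈ firstAgents A a,
        (∫ ω, maxIntegrand P a τ x₀ i ω ∂P) * tailSum (F i) x) atTop (𝓝 1) →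
      AsympEquiv (fun x => condProb P (allLose a τ x₀) (B x))
        (fun x : ℕ => ∑ i ∈ firstAgents A a, (∫ ω, maxIntegrand P a τ x₀ i ω ∂P) /
          P.real (allLose a τ x₀) * tailSum (F i) x) := by
    intro B hB
    refine hB.congr fun x => ?_
    simp only [condProb, div_mul_eq_mul_div]
    rw [← Finset.sum_div, div_div_div_cancel_right₀ hE.ne']
  have hunion : ∀ x, P.real (⋃ i ∈ firstAgents A a, exceedEvent a (rows τ x₀) (x + 1 - x₀ i) i) ≤
      ∑ i ∈ firstAgents A a, U i x := fun x => measureReal_biUnion_finset_le _ _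
  refine ⟨hE, fun i hi t ht => ((h.row i).hasDerivAt_totalTime (hs i hi) ht).differentiableAt,
    hmin_int, hmax_int, ?_, hcond _ ?_, fun hrv => hcond _ ?_⟩
  · have hlim := h.tendsto_iInter_exceedEvent_div hS0 hs (n := fun x i => x + 1 - x₀ i) hn
    rw [← integral_congr_ae hmin_ae] at hlim
    have hlim1 := hlim.div_const (∫ ω, minIntegrand P a τ x₀ ω ∂P)
    rw [div_self hmin_pos.ne'] at hlim1
    refine hlim1.congr' ?_
    filter_upwards [hlarge] with x hx
    have hprod : ∏ i ∈ firstAgents A a, ∑' k, 1 / F i (x₀ i + (k + (x + 1 - x₀ i))) =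
        ∏ i ∈ firstAgents A a, tailSum (F i) x :=
      Finset.prod_congr rfl fun i _ => tsum_rates_eq_tailSum (F i) (hx i)
    have hset : P.real ({ω | (x : ℕ∞) < (firstAgents A a).inf fun i => urnLimit (τ ω) x₀ i} ∩
        allLose a τ x₀) = P.real {ω | (∀ i ∈ firstAgents A a, partialSum (rows τ x₀ i)
          (x + 1 - x₀ i) ω < (minTotal a (rows τ x₀) ω).toReal) ∧
            ω ∈ lossEvent a (rows τ x₀)} := by
      refine measureReal_congr ?_
      filter_upwards [hreg] with ω hω using propext (hω.lt_inf_iff hx)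
    have hE0 := hE.ne'
    simp only [condProb]
    rw [hprod, hset, div_mul_eq_mul_div, div_div_div_cancel_right₀ hE0, div_div, mul_comm]
  · have hset : ∀ᶠ x : ℕ in atTop,
        P.real ({ω | (x : ℕ∞) < (firstAgents A a).sup fun i => urnLimit (τ ω) x₀ i} ∩
          allLose a τ x₀) =
        P.real (⋃ i ∈ firstAgents A a, exceedEvent a (rows τ x₀) (x + 1 - x₀ i) i) := by
      filter_upwards [hlarge] with x hx
      refine measureReal_congr ?_
      filter_upwards [hreg] with ω hω using propext (hω.lt_sup_iff hx)
    refine tendsto_div_sum_of_sum_le hI hr hmax_pos hU hV ?_ ?_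
    · filter_upwards [hset] with x hx
      rw [hx]
      exact h.sum_onlyExceedEvent_le a _
    · filter_upwards [hset] with x hx
      rw [hx]
      exact hunion x
  · refine tendsto_div_sum_of_sum_floor_le hI hr hmax_pos hU hV
      (fun i hi => (hrv i hi).tailSum_floor_le (hF i) (hexpI i hi)) ?_ fun η hη hη1 => ?_
    -- The sum is at least each of its terms, so the lower bound for the maximum carries over.
    · filter_upwards [hlarge] with x hx
      refine (h.sum_onlyExceedEvent_le a _).trans (ENNReal.toReal_mono (measure_ne_top _ _)
        (measure_mono_ae ?_))
      filter_upwards [hreg] with ω hω hmem using hω.lt_sum_of_mem hx hmem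
    · have hcard : (0 : ℝ) < (firstAgents A a).card := by exact_mod_cast hI.card_pos
      filter_upwards [(tendsto_floor_mul (sub_pos.2 hη1)).eventually hlarge,
        (tendsto_floor_mul (div_pos hη hcard)).eventually hlarge] with x hx hx'
      -- Either one limit exceeds `(1 - η) x`, or two exceed the lower level; the latter puts the
      -- path in `exceedEvent` but not in `onlyExceedEvent` there, an event of measure `U - V`.
      have hle : P.real ({ω | (x : ℕ∞) < ∑ i ∈ firstAgents A a, urnLimit (τ ω) x₀ i} ∩
          allLose a τ x₀) ≤ _ := ENNReal.toReal_mono (measure_ne_top _ _) (measure_mono_ae (by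
        filter_upwards [hreg] with ω hω hmem
        exact hω.mem_of_lt_sum hη hη1 hx hx' hmem.1 hmem.2))
      refine hle.trans ((measureReal_union_le _ _).trans (add_le_add (hunion _) ?_))
      refine (measureReal_biUnion_finset_le _ _).trans (Finset.sum_le_sum fun i _ => ?_)
      exact (h.measureReal_exceedEvent_diff a
        (fun i => ⌊η / (firstAgents A a).card * x⌋₊ + 1 - x₀ i) i).le
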